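/- Let $d\in\mathbb{N}$, let $\mathcal{A}$ be a finite set, let $\mathfrak{p}_a\in\mathbb{Z}^d$ for $a\in\mathcal{A}$ be not all equal, and let $q_\Phi$ be an integer with $|q_\Phi|\ge 2$. Consider the equicontractive iterated function system $\Phi=\{\phi_a(x)=(x+\mathfrak{p}_a)/q_\Phi\}_{a\in\mathcal{A}}$ on $\mathbb{R}^d$ with its Euclidean norm $\|\cdot\|$. Let $X$ be its self-similar set, i.e. the unique non-empty compact set with $X=\bigcup_{a\in\mathcal{A}}\phi_a(X)$. Put $s=\frac{\log\#\mathcal{A}}{\log|q_\Phi|}$, which is the similarity dimension of $\Phi$, i.e. the unique solution of $\sum_{a\in\mathcal{A}}|q_\Phi|^{-s}=1$, and let $\mu$ be the self-similar measure with the corresponding weights $|q_\Phi|^{-s}=1/\#\mathcal{A}$, i.e. the unique Borel probability measure on $\mathbb{R}^d$ with $\mu=\sum_{a\in\mathcal{A}}|q_\Phi|^{-s}\,\phi_a\mu$, where $\phi_a\mu$ is the push-forward of $\mu$ under $\phi_a$. Let $\Psi:\{1,2,3,\dots\}\to[0,\infty)$ be non-increasing. If $$\sum_{n=1}^{\infty}n\cdot(\#\mathcal{A})^{n}\cdot\Psi(|q_\Phi|^{n})^{\frac{\log\#\mathcal{A}}{\log|q_\Phi|}}=\infty,$$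 then $$\mu\left(\left\{x\in X:\ \|x-\mathfrak{p}/q\|<\Psi(q)\ \text{for infinitely many } \mathfrak{p}/q\in X\right\}\right)=1,$$ where $\mathfrak{p}/q$ runs over the rational vectors in reduced form: $\mathfrak{p}=(\mathfrak{p}_1,\dots,\mathfrak{p}_d)\in\mathbb{Z}^d$, $q\ge 1$ and $\gcd(\mathfrak{p}_1,\dots,\mathfrak{p}_d,q)=1$. -/

import Mathlib

open MeasureTheory
open scoped ENNReal NNReal

namespace IntrinsicApprox

/-- The integer vector `m ∈ ℤ^d`, seen as a point of `ℝ^d` with its Euclidean norm. -/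
noncomputable def intVec {d : ℕ} (m : Fin d → ℤ) : EuclideanSpace ℝ (Fin d) :=
  WithLp.toLp 2 fun i => (m i : ℝ)

/-- The similarity `φ_a(x) = (x + p_a) / q` of `ℝ^d`. -/
noncomputable def ifsMap {d : ℕ} {A : Type*} (p : A → Fin d → ℤ) (q : ℤ) (a : A)
    (x : EuclideanSpace ℝ (Fin d)) : EuclideanSpace ℝ (Fin d) :=
  ((q : ℝ)⁻¹) • (x + intVec (p a))

/-- `X` is a self-similar set of the maps `φ_a`: it is non-empty, compact, and `X = ⋃ a, φ_a(X)`. -/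
def IsSelfSimilarSet {A E : Type*} [TopologicalSpace E] (φ : A → E → E) (X : Set E) : Prop :=
  X.Nonempty ∧ IsCompact X ∧ X = ⋃ a, φ a '' X

/-- `μ` is a self-similar measure of the maps `φ_a` with weights `w_a`: it is a Borel probability
measure with `μ = ∑ a, w_a · φ_a μ`. -/
def IsSelfSimilarMeasure {A E : Type*} [Fintype A] [MeasurableSpace E] (φ : A → E → E)
    (w : A → ℝ≥0∞) (μ : Measure E) : Prop :=
  IsProbabilityMeasure μ ∧ μ = ∑ a, w a • μ.map (φ a)

/-- The similarity dimension `log #A / log |q|` of the IFS `{(x + p_a) / q}_{a ∈ A}`, all of whose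
contraction ratios are `1 / |q|`. -/
noncomputable def similarityDim (A : Type*) [Fintype A] (q : ℤ) : ℝ :=
  Real.log (Fintype.card A) / Real.log (q.natAbs : ℝ)

/-- The weights `r_a ^ s` with `r_a = 1 / |q|` and `s` the similarity dimension. -/
noncomputable def naturalWeight (A : Type*) [Fintype A] (q : ℤ) (_ : A) : ℝ≥0∞ :=
  ENNReal.ofReal (((q.natAbs : ℝ)⁻¹) ^ similarityDim A q)

section Basic

variable {d : ℕ} {A : Type*} [Fintype A]

theorem one_lt_natAbs_cast {q : ℤ} (hq : 2 ≤ q.natAbs) : (1 : ℝ) < (q.natAbs : ℝ) := by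
  exact_mod_cast hq

theorem abs_inv_lt_one {q : ℤ} (hq : 2 ≤ q.natAbs) : |(q : ℝ)⁻¹| < 1 := by
  have h : |(q : ℝ)| = (q.natAbs : ℝ) := by
    rw [Nat.cast_natAbs, Int.cast_abs]
  rw [abs_inv, h]
  exact inv_lt_one_of_one_lt₀ (one_lt_natAbs_cast hq)

theorem ratio_rpow_similarityDim [Nonempty A] {q : ℤ} (hq : 2 ≤ q.natAbs) :
    ((q.natAbs : ℝ)⁻¹) ^ similarityDim A q = ((Fintype.card A : ℝ))⁻¹ := by
  have h1 := one_lt_natAbs_cast hq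
  have h0 : (0 : ℝ) < (q.natAbs : ℝ) := by linarith
  have hl : Real.log (q.natAbs : ℝ) ≠ 0 := (Real.log_pos h1).ne'
  have hc : (0 : ℝ) < (Fintype.card A : ℝ) := by exact_mod_cast Fintype.card_pos
  rw [Real.inv_rpow h0.le, Real.rpow_def_of_pos h0, similarityDim, mul_div_cancel₀ _ hl,
    Real.exp_log hc]

/-- `similarityDim A q` is the unique solution `s` of `∑ a, r_a ^ s = 1`, where `r_a = 1 / |q|`. -/
theorem sum_ratio_rpow_eq_one_iff [Nonempty A] {q : ℤ} (hq : 2 ≤ q.natAbs) (s : ℝ) :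
    ∑ _a : A, ((q.natAbs : ℝ)⁻¹) ^ s = 1 ↔ s = similarityDim A q := by
  have h1 := one_lt_natAbs_cast hq
  have h0 : (0 : ℝ) < (q.natAbs : ℝ) := by linarith
  have hc : (Fintype.card A : ℝ) ≠ 0 := by exact_mod_cast Fintype.card_ne_zero
  rw [Finset.sum_const, Finset.card_univ, nsmul_eq_mul]
  constructor
  · intro h
    have h2 : ((q.natAbs : ℝ)⁻¹) ^ s = ((q.natAbs : ℝ)⁻¹) ^ similarityDim A q := by
      rw [ratio_rpow_similarityDim hq]
      exact eq_inv_of_mul_eq_one_right h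
    exact (Real.rpow_right_inj (inv_pos.mpr h0) (inv_lt_one_of_one_lt₀ h1).ne).mp h2
  · rintro rfl
    rw [ratio_rpow_similarityDim hq, mul_inv_cancel₀ hc]

theorem naturalWeight_eq [Nonempty A] {q : ℤ} (hq : 2 ≤ q.natAbs) (a : A) :
    naturalWeight A q a = ((Fintype.card A : ℝ≥0∞))⁻¹ := by
  have hc : (0 : ℝ) < (Fintype.card A : ℝ) := by exact_mod_cast Fintype.card_pos
  rw [naturalWeight, ratio_rpow_similarityDim hq, ENNReal.ofReal_inv_of_pos hc,
    ENNReal.ofReal_natCast]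

theorem continuous_ifsMap {A : Type*} (p : A → Fin d → ℤ) (q : ℤ) (a : A) : Continuous (ifsMap p q a) := by
  unfold ifsMap
  fun_prop

theorem dist_ifsMap {A : Type*} (p : A → Fin d → ℤ) (q : ℤ) (a : A) (x y : EuclideanSpace ℝ (Fin d)) :
    dist (ifsMap p q a x) (ifsMap p q a y) = |(q : ℝ)⁻¹| * dist x y := by
  simp [ifsMap, dist_smul₀, Real.norm_eq_abs]

/-- The coding map `π(a₁ a₂ …) = ∑ n, p_{a_n} / q ^ n`. -/
noncomputable def coding (p : A → Fin d → ℤ) (q : ℤ) (i : ℕ → A) : EuclideanSpace ℝ (Fin d) :=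
  ∑' n, ((q : ℝ)⁻¹) ^ (n + 1) • intVec (p (i n))

theorem exists_norm_intVec_le (p : A → Fin d → ℤ) : ∃ C, ∀ a, ‖intVec (p a)‖ ≤ C := by
  refine ⟨∑ a, ‖intVec (p a)‖, fun a => ?_⟩
  exact Finset.single_le_sum (f := fun a => ‖intVec (p a)‖) (fun _ _ => norm_nonneg _)
    (Finset.mem_univ a)

theorem exists_coding_bound (p : A → Fin d → ℤ) {q : ℤ} (hq : 2 ≤ q.natAbs) :
    ∃ u : ℕ → ℝ, Summable u ∧
      ∀ n (i : ℕ → A), ‖((q : ℝ)⁻¹) ^ (n + 1) • intVec (p (i n))‖ ≤ u n := by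
  obtain ⟨C, hC⟩ := exists_norm_intVec_le p
  refine ⟨fun n => |(q : ℝ)⁻¹| ^ (n + 1) * C, ?_, fun n i => ?_⟩
  · exact (((summable_nat_add_iff 1).mpr
      (summable_geometric_of_lt_one (abs_nonneg _) (abs_inv_lt_one hq)))).mul_right C
  · rw [norm_smul, norm_pow, Real.norm_eq_abs]
    exact mul_le_mul_of_nonneg_left (hC _) (by positivity)

theorem summable_coding (p : A → Fin d → ℤ) {q : ℤ} (hq : 2 ≤ q.natAbs) (i : ℕ → A) :
    Summable fun n => ((q : ℝ)⁻¹) ^ (n + 1) • intVec (p (i n)) := by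
  obtain ⟨u, hu, hb⟩ := exists_coding_bound p hq
  exact Summable.of_norm_bounded hu fun n => hb n i

/-- Prepending a letter to a sequence. -/
def consSeq {A : Type*} (x : A × (ℕ → A)) : ℕ → A
  | 0 => x.1
  | n + 1 => x.2 n

theorem coding_consSeq (p : A → Fin d → ℤ) {q : ℤ} (hq : 2 ≤ q.natAbs) (a : A) (i : ℕ → A) :
    coding p q (consSeq (a, i)) = ifsMap p q a (coding p q i) := by
  have h := (summable_coding p hq (consSeq (a, i))).tsum_eq_zero_add
  have e : ∀ n : ℕ, ((q : ℝ)⁻¹) ^ (n + 1 + 1) • intVec (p (i n))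
      = (q : ℝ)⁻¹ • (((q : ℝ)⁻¹) ^ (n + 1) • intVec (p (i n))) := by
    intro n
    rw [smul_smul, ← pow_succ']
  unfold coding ifsMap
  rw [h]
  simp only [consSeq, e]
  rw [(summable_coding p hq i).tsum_const_smul]
  simp [smul_add, add_comm]

theorem continuous_coding [TopologicalSpace A] [DiscreteTopology A] (p : A → Fin d → ℤ) {q : ℤ}
    (hq : 2 ≤ q.natAbs) : Continuous (coding p q) := by
  obtain ⟨u, hu, hb⟩ := exists_coding_bound p hq
  refine continuous_tsum (fun n => ?_) hu hb
  have : Continuous fun a : A => intVec (p a) := continuous_of_discreteTopology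
  have h2 : Continuous fun i : ℕ → A => intVec (p (i n)) := this.comp (continuous_apply n)
  exact h2.const_smul (((q : ℝ)⁻¹) ^ (n + 1))

theorem isSelfSimilarSet_range_coding [Nonempty A] (p : A → Fin d → ℤ) {q : ℤ}
    (hq : 2 ≤ q.natAbs) : IsSelfSimilarSet (ifsMap p q) (Set.range (coding p q)) := by
  let : TopologicalSpace A := ⊥
  have : DiscreteTopology A := ⟨rfl⟩
  refine ⟨Set.range_nonempty _, isCompact_range (continuous_coding p hq), ?_⟩
  ext x
  simp only [Set.mem_range, Set.mem_iUnion, Set.mem_image]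
  constructor
  · rintro ⟨i, rfl⟩
    refine ⟨i 0, _, ⟨fun n => i (n + 1), rfl⟩, ?_⟩
    rw [← coding_consSeq p hq]
    congr 1
    funext n
    cases n <;> rfl
  · rintro ⟨a, _, ⟨i, rfl⟩, rfl⟩
    exact ⟨consSeq (a, i), coding_consSeq p hq a i⟩

theorem IsSelfSimilarSet.subset {A : Type*} {p : A → Fin d → ℤ} {q : ℤ} (hq : 2 ≤ q.natAbs)
    {K L : Set (EuclideanSpace ℝ (Fin d))} (hK : IsSelfSimilarSet (ifsMap p q) K)
    (hL : IsSelfSimilarSet (ifsMap p q) L) : K ⊆ L := by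
  obtain ⟨x, hx, hmax⟩ := hK.2.1.exists_isMaxOn hK.1
    (Metric.continuous_infDist_pt L).continuousOn
  have hx' := hx
  rw [hK.2.2, Set.mem_iUnion] at hx'
  obtain ⟨a, y, hy, rfl⟩ := hx'
  obtain ⟨z, hz, hyz⟩ := hL.2.1.exists_infDist_eq_dist hL.1 y
  have hzL : ifsMap p q a z ∈ L := by
    rw [hL.2.2]
    exact Set.mem_iUnion.mpr ⟨a, z, hz, rfl⟩
  have h1 := Metric.infDist_le_dist_of_mem (x := ifsMap p q a y) hzL
  rw [dist_ifsMap, ← hyz] at h1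
  have h2 : Metric.infDist y L ≤ Metric.infDist (ifsMap p q a y) L := hmax hy
  have h3 := abs_inv_lt_one hq
  have h4 : 0 ≤ Metric.infDist y L := Metric.infDist_nonneg
  have h5 : Metric.infDist (ifsMap p q a y) L ≤ 0 := by
    nlinarith [abs_nonneg ((q : ℝ)⁻¹)]
  intro w hw
  have h6 : Metric.infDist w L ≤ Metric.infDist (ifsMap p q a y) L := hmax hw
  exact (hL.2.1.isClosed.mem_iff_infDist_zero hL.1).mpr
    (le_antisymm (h6.trans h5) Metric.infDist_nonneg)

/-- There is exactly one self-similar set of the IFS. -/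
theorem existsUnique_isSelfSimilarSet [Nonempty A] (p : A → Fin d → ℤ) {q : ℤ}
    (hq : 2 ≤ q.natAbs) : ∃! X, IsSelfSimilarSet (ifsMap p q) X :=
  ⟨_, isSelfSimilarSet_range_coding p hq, fun _ hY =>
    Set.Subset.antisymm (hY.subset hq (isSelfSimilarSet_range_coding p hq))
      ((isSelfSimilarSet_range_coding p hq).subset hq hY)⟩

end Basic

section Measures

variable {d : ℕ} {A : Type*} [Fintype A]

theorem measurable_consSeq {A : Type*} [MeasurableSpace A] : Measurable (consSeq (A := A)) := by
  refine measurable_pi_lambda _ fun n => ?_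
  cases n with
  | zero => exact measurable_fst
  | succ n => exact (measurable_pi_apply n).comp measurable_snd

theorem measurable_consSeq_mk {A : Type*} [MeasurableSpace A] (a : A) :
    Measurable fun i : ℕ → A => consSeq (a, i) :=
  measurable_consSeq.comp measurable_prodMk_left

theorem map_consSeq_prod_infinitePi {A : Type*} [MeasurableSpace A] (u : Measure A)
    [IsProbabilityMeasure u] :
    (u.prod (Measure.infinitePi fun _ : ℕ => u)).map consSeq = Measure.infinitePi fun _ => u := by
  classical
  refine Measure.eq_infinitePi _ fun s t ht => ?_
  set t' : ℕ → Set A := fun n => if n ∈ s then t n else Set.univ with ht'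
  have hm : ∀ n, MeasurableSet (t' n) := by
    intro n
    simp only [ht']
    split_ifs
    · exact ht n
    · exact MeasurableSet.univ
  obtain ⟨N, hN⟩ : ∃ N, s ⊆ Finset.range (N + 1) :=
    ⟨s.sup id, fun n hn => Finset.mem_range_succ_iff.mpr (Finset.le_sup (f := id) hn)⟩
  have e1 : Set.pi (s : Set ℕ) t = Set.pi (Finset.range (N + 1) : Set ℕ) t' := by
    ext x
    simp only [Set.mem_pi, Finset.mem_coe, ht']
    constructor
    · intro h n _
      split_ifs with hn
      · exact h n hn
      · trivial
    · intro h n hn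
      simpa [hn] using h n (hN hn)
  have e2 : ∏ n ∈ s, u (t n) = ∏ n ∈ Finset.range (N + 1), u (t' n) := by
    rw [← Finset.prod_subset hN]
    · refine Finset.prod_congr rfl fun n hn => ?_
      simp [ht', hn]
    · intro n _ hn
      simp [ht', hn]
  have e3 : consSeq ⁻¹' (Set.pi (Finset.range (N + 1) : Set ℕ) t')
      = t' 0 ×ˢ Set.pi (Finset.range N : Set ℕ) fun n => t' (n + 1) := by
    ext ⟨a, i⟩
    simp only [Set.mem_preimage, Set.mem_pi, Finset.mem_coe, Finset.mem_range, Set.mem_prod]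
    constructor
    · intro h
      exact ⟨h 0 (by omega), fun n hn => h (n + 1) (by omega)⟩
    · rintro ⟨h0, h1⟩ n hn
      cases n with
      | zero => exact h0
      | succ n => exact h1 n (by omega)
  rw [e1, e2, Measure.map_apply measurable_consSeq
    (MeasurableSet.pi (Finset.countable_toSet _) fun n _ => hm n), e3, Measure.prod_prod,
    Measure.infinitePi_pi _ (fun n _ => hm (n + 1)), Finset.prod_range_succ', mul_comm]

theorem exists_isSelfSimilarMeasure [Nonempty A] (p : A → Fin d → ℤ) {q : ℤ}
    (hq : 2 ≤ q.natAbs) :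
    ∃ μ, IsSelfSimilarMeasure (ifsMap p q) (naturalWeight A q) μ := by
  let : MeasurableSpace A := ⊤
  let : TopologicalSpace A := ⊥
  have : DiscreteTopology A := ⟨rfl⟩
  have : BorelSpace A := ⟨borel_eq_top_of_discrete.symm⟩
  let u : Measure A := ∑ a : A, ((Fintype.card A : ℝ≥0∞))⁻¹ • Measure.dirac a
  have hu : IsProbabilityMeasure u := by
    constructor
    simp only [u, Measure.coe_finsetSum, Finset.sum_apply, Measure.smul_apply, measure_univ,
      smul_eq_mul, mul_one, Finset.sum_const, Finset.card_univ, nsmul_eq_mul]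
    exact ENNReal.mul_inv_cancel (by exact_mod_cast Fintype.card_ne_zero)
      (ENNReal.natCast_ne_top _)
  let m : Measure (ℕ → A) := Measure.infinitePi fun _ => u
  have hcm : Measurable (coding p q) := (continuous_coding p hq).measurable
  refine ⟨m.map (coding p q), Measure.isProbabilityMeasure_map hcm.aemeasurable, ?_⟩
  have hm : m = ∑ a : A, ((Fintype.card A : ℝ≥0∞))⁻¹ • m.map fun i => consSeq (a, i) := by
    have h := map_consSeq_prod_infinitePi u
    change (u.prod m).map consSeq = m at h
    refine h.symm.trans ?_
    ext S hS
    rw [Measure.map_apply measurable_consSeq hS, Measure.prod_apply (measurable_consSeq hS)]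
    simp only [u, lintegral_finsetSum_measure, lintegral_smul_measure, lintegral_dirac,
      Measure.coe_finsetSum, Finset.sum_apply, Measure.smul_apply]
    refine Finset.sum_congr rfl fun a _ => ?_
    rw [Measure.map_apply (measurable_consSeq_mk a) hS]
    rfl
  have hterm : ∀ a : A, (m.map fun i => consSeq (a, i)).map (coding p q)
      = (m.map (coding p q)).map (ifsMap p q a) := by
    intro a
    rw [Measure.map_map hcm (measurable_consSeq_mk a),
      Measure.map_map (continuous_ifsMap p q a).measurable hcm]
    congr 1
    funext i
    exact coding_consSeq p hq a i
  simp only [naturalWeight_eq hq]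
  conv_lhs => rw [hm]
  ext S hS
  rw [Measure.map_apply hcm hS]
  simp only [Measure.coe_finsetSum, Finset.sum_apply, Measure.smul_apply, ← hterm]
  refine Finset.sum_congr rfl fun a _ => ?_
  rw [Measure.map_apply hcm hS]

theorem charFun_eq_of_isSelfSimilarMeasure [Nonempty A] {p : A → Fin d → ℤ} {q : ℤ}
    (hq : 2 ≤ q.natAbs) {μ : Measure (EuclideanSpace ℝ (Fin d))}
    (hμ : IsSelfSimilarMeasure (ifsMap p q) (naturalWeight A q) μ)
    (t : EuclideanSpace ℝ (Fin d)) :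
    charFun μ t = ((Fintype.card A : ℂ)⁻¹ *
      ∑ a : A, Complex.exp (inner ℝ (intVec (p a)) ((q : ℝ)⁻¹ • t) * Complex.I)) *
        charFun μ ((q : ℝ)⁻¹ • t) := by
  have := hμ.1
  have hmap : ∀ a, charFun (μ.map (ifsMap p q a)) t =
      Complex.exp (inner ℝ (intVec (p a)) ((q : ℝ)⁻¹ • t) * Complex.I) *
        charFun μ ((q : ℝ)⁻¹ • t) := by
    intro a
    have : μ.map (ifsMap p q a)
        = (μ.map fun x => x + intVec (p a)).map fun x => (q : ℝ)⁻¹ • x := by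
      rw [Measure.map_map (by fun_prop) (by fun_prop)]
      rfl
    rw [this, charFun_map_smul, charFun_map_add_const, mul_comm]
  have hint : ∀ (ν : Measure (EuclideanSpace ℝ (Fin d))) [IsFiniteMeasure ν],
      Integrable (fun x => Complex.exp (inner ℝ x t * Complex.I)) ν := by
    intro ν _
    refine Integrable.of_bound (C := 1) (by fun_prop) (Filter.Eventually.of_forall fun x => ?_)
    rw [Complex.norm_exp_ofReal_mul_I]
  have h1 : charFun μ t = ∑ a : A, (Fintype.card A : ℂ)⁻¹ * charFun (μ.map (ifsMap p q a)) t := by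
    conv_lhs => rw [hμ.2]
    simp only [naturalWeight_eq hq]
    rw [charFun_apply, integral_finsetSum_measure]
    · refine Finset.sum_congr rfl fun a _ => ?_
      rw [integral_smul_measure, charFun_apply]
      simp
    · intro a _
      exact (hint _).smul_measure (by simp)
  rw [h1, Finset.mul_sum, Finset.sum_mul]
  refine Finset.sum_congr rfl fun a _ => ?_
  rw [hmap a, mul_assoc]

theorem IsSelfSimilarMeasure.unique [Nonempty A] {p : A → Fin d → ℤ} {q : ℤ}
    (hq : 2 ≤ q.natAbs) {μ ν : Measure (EuclideanSpace ℝ (Fin d))}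
    (hμ : IsSelfSimilarMeasure (ifsMap p q) (naturalWeight A q) μ)
    (hν : IsSelfSimilarMeasure (ifsMap p q) (naturalWeight A q) ν) : μ = ν := by
  have := hμ.1
  have := hν.1
  refine Measure.ext_of_charFun (funext fun t => ?_)
  have hstep : ∀ s, ‖charFun μ s - charFun ν s‖
      ≤ ‖charFun μ ((q : ℝ)⁻¹ • s) - charFun ν ((q : ℝ)⁻¹ • s)‖ := by
    intro s
    rw [charFun_eq_of_isSelfSimilarMeasure hq hμ s, charFun_eq_of_isSelfSimilarMeasure hq hν s,
      ← mul_sub, norm_mul]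
    refine mul_le_of_le_one_left (norm_nonneg _) ?_
    have hc : (0 : ℝ) < (Fintype.card A : ℝ) := by exact_mod_cast Fintype.card_pos
    rw [norm_mul, norm_inv, Complex.norm_natCast, inv_mul_le_iff₀ hc, mul_one]
    refine (norm_sum_le _ _).trans ?_
    simp [Complex.norm_exp_ofReal_mul_I]
  have hiter : ∀ n : ℕ, ‖charFun μ t - charFun ν t‖
      ≤ ‖charFun μ (((q : ℝ)⁻¹) ^ n • t) - charFun ν (((q : ℝ)⁻¹) ^ n • t)‖ := by
    intro n
    induction n with
    | zero => simp
    | succ n ih =>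
      refine ih.trans ((hstep _).trans (le_of_eq ?_))
      rw [smul_smul, ← pow_succ']
  have hz : Filter.Tendsto (fun n : ℕ => ((q : ℝ)⁻¹) ^ n • t) Filter.atTop (nhds 0) := by
    have := (tendsto_pow_atTop_nhds_zero_of_abs_lt_one (abs_inv_lt_one hq)).smul_const t
    simpa using this
  have hlim : Filter.Tendsto (fun n : ℕ =>
      ‖charFun μ (((q : ℝ)⁻¹) ^ n • t) - charFun ν (((q : ℝ)⁻¹) ^ n • t)‖)
      Filter.atTop (nhds 0) := by
    have hcont : Continuous fun s => ‖charFun μ s - charFun ν s‖ :=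
      ((continuous_charFun (μ := μ)).sub (continuous_charFun (μ := ν))).norm
    have := (hcont.tendsto 0).comp hz
    simpa [charFun_zero, Function.comp_def] using this
  have h0 : ‖charFun μ t - charFun ν t‖ ≤ 0 := ge_of_tendsto' hlim hiter
  exact sub_eq_zero.mp (norm_le_zero_iff.mp h0)

/-- There is exactly one self-similar measure of the IFS with the natural weights. -/
theorem existsUnique_isSelfSimilarMeasure [Nonempty A] (p : A → Fin d → ℤ) {q : ℤ}
    (hq : 2 ≤ q.natAbs) :
    ∃! μ, IsSelfSimilarMeasure (ifsMap p q) (naturalWeight A q) μ := by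
  obtain ⟨μ, hμ⟩ := exists_isSelfSimilarMeasure p hq
  exact ⟨μ, hμ, fun _ hν => hν.unique hq hμ⟩

end Measures

/-- The self-similar set `X` of the IFS `{(x + p_a) / q}_{a ∈ A}`. -/
noncomputable def selfSimilarSet {d : ℕ} {A : Type*} [Fintype A] [Nonempty A]
    (p : A → Fin d → ℤ) (q : ℤ) (hq : 2 ≤ q.natAbs) : Set (EuclideanSpace ℝ (Fin d)) :=
  (existsUnique_isSelfSimilarSet p hq).choose

/-- The self-similar measure `μ` of the IFS `{(x + p_a) / q}_{a ∈ A}` with the natural weights. -/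
noncomputable def selfSimilarMeasure {d : ℕ} {A : Type*} [Fintype A] [Nonempty A]
    (p : A → Fin d → ℤ) (q : ℤ) (hq : 2 ≤ q.natAbs) : Measure (EuclideanSpace ℝ (Fin d)) :=
  (existsUnique_isSelfSimilarMeasure p hq).choose

/-- The pair `(m, n)` is a rational vector `m / n` in reduced form: `n ≥ 1`, and no integer larger
than `1` divides `n` and all the entries of `m`. -/
def IsReduced {d : ℕ} (m : Fin d → ℤ) (n : ℕ) : Prop :=
  1 ≤ n ∧ ∀ k : ℕ, k ∣ n → (∀ i, (k : ℤ) ∣ m i) → k = 1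

/-- The rational vector `m / n`. -/
noncomputable def ratVec {d : ℕ} (m : Fin d → ℤ) (n : ℕ) : EuclideanSpace ℝ (Fin d) :=
  ((n : ℝ)⁻¹) • intVec m

/-- The points `x ∈ X` with `‖x - m / n‖ < Ψ(n)` for infinitely many rational vectors
`m / n ∈ X` in reduced form. -/
def wellApproximable {d : ℕ} (X : Set (EuclideanSpace ℝ (Fin d))) (Ψ : ℕ → ℝ≥0) :
    Set (EuclideanSpace ℝ (Fin d)) :=
  {x | x ∈ X ∧ {mn : (Fin d → ℤ) × ℕ | IsReduced mn.1 mn.2 ∧ ratVec mn.1 mn.2 ∈ X ∧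
    ‖x - ratVec mn.1 mn.2‖ < (Ψ mn.2 : ℝ)}.Infinite}

end IntrinsicApprox

/-! # Intrinsic Khintchine theorem on self-similar sets: the divergence case

Let `Q = |q|` and `c = #A`. The self-similar measure is the distribution of the coding
`∑ n, p_{x_n} / q ^ (n + 1)` of a sequence `x` of independent uniform letters
(`selfSimilarMeasure_eq_map`), and sequences that agree in their first `m` letters have codings at
distance `O(Q ^ (-m))` (`exists_dist_coding_le`). The coding of an eventually periodic sequence with
preperiod `k` and period `l` is a rational vector in `X` of denominator at most `Q ^ (k + l + 1)`
(`exists_isReduced_of_periodic`). Hence `x` is well approximable if there are infinitely many `m`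
such that, with `n ≤ m` as large as possible subject to `D * Q ^ (-m) < Ψ (Q ^ (n + 1))`, the
letters of `x` in the window `[n, m)` repeat those of an earlier window `[k, k + m - n)`: then `x`
agrees up to `m` with an eventually periodic sequence for which preperiod and period add up to `n`
(`coding_mem_wellApproximable`). No separation of the pieces `φ_a(X)` is needed, because all this
takes place on sequences.

Each of the repetitions has probability `c ^ (n - m)`, and there are about `n` choices of `k`. So the
expected number of repetitions is comparable to `∑ m, n(m) * c ^ (n(m) - m)`, which diverges with the
Khintchine sum (`summable_of_summable_windowStart`); keeping only the largest `n` for each `m` costs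
a constant factor, as a geometric sum is dominated by its last term. That infinitely many repetitions
do occur is shown by the second moment method (`ae_frequently_repeatSet`). A family of coincidences
`x_i = x_j` is independent if the pairs `{i, j}` form a forest (`bernoulli_forest`). Two repetitions
with different lags give a forest, even if their windows overlap, when the letters that they copy
lie before both windows (`bernoulli_repeatSet_inter_of_lt`): a path then moves alternately up by one
lag and down by the other, and so it drifts and never returns. To ensure this, only short windows
and `k < n / 4` are kept, which does not affect the divergence (`not_summable_short_windows`). For equal lags the correlation decays geometrically with the distance of the windows
(`bernoulli_repeatSet_inter_same`).

Finally, the rational vectors obtained are infinitely many, because their distances to the coding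
of `x` tend to `0` and that coding is almost surely irrational, the measure having no atoms
(`measure_singleton_eq_zero`). -/

namespace IntrinsicApprox

/-! ### The uniform Bernoulli measure on sequences -/

section Bernoulli

variable {A : Type*} [Fintype A] [MeasurableSpace A]

/-- The uniform probability measure on the finite alphabet `A`. -/
noncomputable def uniformMeasure (A : Type*) [Fintype A] [MeasurableSpace A] : Measure A :=
  ∑ a : A, ((Fintype.card A : ℝ≥0∞))⁻¹ • Measure.dirac a

instance [Nonempty A] : IsProbabilityMeasure (uniformMeasure A) := by
  constructor
  simp only [uniformMeasure, Measure.coe_finsetSum, Finset.sum_apply, Measure.smul_apply,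
    measure_univ, smul_eq_mul, mul_one, Finset.sum_const, Finset.card_univ, nsmul_eq_mul]
  exact ENNReal.mul_inv_cancel (by exact_mod_cast Fintype.card_ne_zero)
    (ENNReal.natCast_ne_top _)

/-- The Bernoulli measure on `A^ℕ`, under which the letters are independent and uniform. -/
noncomputable def bernoulli (A : Type*) [Fintype A] [MeasurableSpace A] [Nonempty A] :
    Measure (ℕ → A) :=
  Measure.infinitePi fun _ => uniformMeasure A

instance [Nonempty A] : IsProbabilityMeasure (bernoulli A) := by
  unfold bernoulli
  infer_instance

variable [DiscreteMeasurableSpace A]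

theorem map_perm_uniformMeasure (e : Equiv.Perm A) :
    (uniformMeasure A).map e = uniformMeasure A := by
  ext S hS
  rw [Measure.map_apply (measurable_of_countable _) hS]
  simp only [uniformMeasure, Measure.coe_finsetSum, Finset.sum_apply, Measure.smul_apply,
    Measure.dirac_apply' _ hS, Measure.dirac_apply' _ (MeasurableSet.of_discrete (s := e ⁻¹' S))]
  exact Fintype.sum_equiv e _ _ fun a => rfl

variable [Nonempty A]

/-- Permuting the values of a single letter preserves the Bernoulli measure. -/
theorem measurePreserving_update_perm (b : ℕ) (e : Equiv.Perm A) :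
    MeasurePreserving (fun x : ℕ → A => Function.update x b (e (x b)))
      (bernoulli A) (bernoulli A) := by
  let f : ℕ → A → A := fun i => if i = b then e else id
  have hf : ∀ i, Measurable (f i) := fun i => measurable_of_countable _
  have hfun : (fun x : ℕ → A => Function.update x b (e (x b))) = fun x i => f i (x i) := by
    funext x i
    by_cases h : i = b
    · subst h; simp [f]
    · simp [f, h]
  rw [hfun]
  refine ⟨measurable_pi_lambda _ fun i => (hf i).comp (measurable_pi_apply i), ?_⟩
  unfold bernoulli
  have := Measure.infinitePi_map_pi (fun _ : ℕ => uniformMeasure A) hf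
  rw [this]
  congr 1
  funext i
  by_cases h : i = b
  · simp [f, h, map_perm_uniformMeasure]
  · simp [f, h]

/-- `F` does not depend on the letter at position `b`. -/
def IndepOfLetter (F : Set (ℕ → A)) (b : ℕ) : Prop :=
  ∀ x v, Function.update x b v ∈ F ↔ x ∈ F

theorem bernoulli_inter_letter {F : Set (ℕ → A)} (hF : MeasurableSet F) {b : ℕ}
    (hb : IndepOfLetter F b) (v : A) :
    (bernoulli A).real (F ∩ {x | x b = v}) = (bernoulli A).real F * (Fintype.card A : ℝ)⁻¹ := by
  classical
  have hm : ∀ v : A, MeasurableSet {x : ℕ → A | x b = v} := fun v =>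
    (MeasurableSet.of_discrete (s := {v})).preimage (measurable_pi_apply b)
  have hconst : ∀ w : A,
      (bernoulli A).real (F ∩ {x | x b = w}) = (bernoulli A).real (F ∩ {x | x b = v}) := by
    intro w
    have h := (measurePreserving_update_perm (A := A) b (Equiv.swap v w)).measureReal_preimage
      (s := F ∩ {x | x b = v}) (hF.inter (hm v)).nullMeasurableSet
    rw [← h]
    congr 1
    ext x
    simp only [Set.mem_inter_iff, Set.mem_ofPred_eq, Set.mem_preimage, hb x, Function.update_self]
    rw [Equiv.swap_apply_eq_iff, Equiv.swap_apply_left]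
  have hsum : (bernoulli A).real F = ∑ w : A, (bernoulli A).real (F ∩ {x | x b = w}) := by
    rw [← measureReal_biUnion_finset]
    · congr 1
      ext x
      simp
    · intro w _ w' _ hww
      refine Set.disjoint_left.mpr fun x hx hx' => hww ?_
      exact hx.2.symm.trans hx'.2
    · exact fun w _ => hF.inter (hm w)
  rw [hsum, Finset.sum_congr rfl fun w _ => hconst w, Finset.sum_const, Finset.card_univ,
    nsmul_eq_mul]
  have hc : (Fintype.card A : ℝ) ≠ 0 := by exact_mod_cast Fintype.card_ne_zero
  field_simp

/-- A coincidence with a letter that the event `F` does not look at has conditional probability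
`1 / #A`. -/
theorem bernoulli_inter_eq_letter {F : Set (ℕ → A)} (hF : MeasurableSet F) {a b : ℕ} (hab : a ≠ b)
    (hb : IndepOfLetter F b) :
    (bernoulli A).real (F ∩ {x | x a = x b}) =
      (bernoulli A).real F * (Fintype.card A : ℝ)⁻¹ := by
  classical
  have hm : ∀ (i : ℕ) (v : A), MeasurableSet {x : ℕ → A | x i = v} := fun i v =>
    (MeasurableSet.of_discrete (s := {v})).preimage (measurable_pi_apply i)
  have e1 : F ∩ {x | x a = x b} =
      ⋃ u ∈ (Finset.univ : Finset A), (F ∩ {x | x a = u}) ∩ {x | x b = u} := by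
    ext x
    simp only [Set.mem_inter_iff, Set.mem_ofPred_eq, Set.mem_iUnion, Finset.mem_univ,
      exists_prop]
    constructor
    · rintro ⟨h1, h2⟩
      exact ⟨x a, by simp [h1, h2]⟩
    · rintro ⟨u, -, ⟨h1, h2⟩, h3⟩
      exact ⟨h1, h2.trans h3.symm⟩
  have e2 : F = ⋃ u ∈ (Finset.univ : Finset A), (F ∩ {x | x a = u}) := by
    ext x
    simp
  rw [e1, measureReal_biUnion_finset]
  · conv_rhs => rw [e2]
    rw [measureReal_biUnion_finset, Finset.sum_mul]
    · refine Finset.sum_congr rfl fun u _ => bernoulli_inter_letter (hF.inter (hm a u)) ?_ u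
      intro x v
      simp only [Set.mem_inter_iff, hb x v, Set.mem_ofPred_eq, Function.update_of_ne hab]
    · intro w _ w' _ hww
      refine Set.disjoint_left.mpr fun x hx hx' => hww ?_
      exact hx.2.symm.trans hx'.2
    · exact fun w _ => hF.inter (hm a w)
  · intro w _ w' _ hww
    refine Set.disjoint_left.mpr fun x hx hx' => hww ?_
    exact hx.2.symm.trans hx'.2
  · exact fun w _ => (hF.inter (hm a w)).inter (hm b w)

/-- The probability of a family of coincidences `x (u i) = x (w i)` is `#A ^ (-#I)` as soon as each
position `w i` is new: it differs from `u i` and from all `u j`, `w j` with `j < i`. In graph terms,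
the edges `{u i, w i}` form a forest. -/
theorem bernoulli_forest (I : Finset ℕ) (u w : ℕ → ℕ) (huw : ∀ i ∈ I, w i ≠ u i)
    (hu : ∀ i ∈ I, ∀ j ∈ I, j < i → w i ≠ u j) (hw : ∀ i ∈ I, ∀ j ∈ I, j < i → w i ≠ w j) :
    (bernoulli A).real {x | ∀ i ∈ I, x (u i) = x (w i)} = ((Fintype.card A : ℝ)⁻¹) ^ I.card := by
  induction I using Finset.induction_on_max with
  | empty => simp
  | insert a s ha ih =>
    have has : a ∉ s := fun h => (ha a h).false
    have hset : {x : ℕ → A | ∀ i ∈ insert a s, x (u i) = x (w i)} =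
        {x | ∀ i ∈ s, x (u i) = x (w i)} ∩ {x | x (u a) = x (w a)} := by
      ext x
      simp only [Finset.forall_mem_insert, Set.mem_ofPred_eq, Set.mem_inter_iff]
      exact and_comm
    have hmeas : MeasurableSet {x : ℕ → A | ∀ i ∈ s, x (u i) = x (w i)} := by
      have : {x : ℕ → A | ∀ i ∈ s, x (u i) = x (w i)} =
          ⋂ i ∈ s, {x | x (u i) = x (w i)} := by
        ext x
        simp
      rw [this]
      exact Finset.measurableSet_biInter _ fun i _ =>
        measurableSet_eq_fun (measurable_pi_apply _) (measurable_pi_apply _)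
    have hI := Finset.mem_insert_self a s
    have hin : ∀ i ∈ s, i ∈ insert a s := fun i hi => Finset.mem_insert_of_mem hi
    rw [hset, bernoulli_inter_eq_letter hmeas (huw a hI).symm, ih, Finset.card_insert_of_notMem has,
      pow_succ]
    · exact fun i hi => huw i (hin i hi)
    · exact fun i hi j hj => hu i (hin i hi) j (hin j hj)
    · exact fun i hi j hj => hw i (hin i hi) j (hin j hj)
    · intro x v
      simp only [Set.mem_ofPred_eq]
      refine forall₂_congr fun i hi => ?_
      rw [Function.update_of_ne (hu a hI i (hin i hi) (ha i hi)).symm,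
        Function.update_of_ne (hw a hI i (hin i hi) (ha i hi)).symm]

end Bernoulli

/-! ### Repetitions of a window -/

section Repetition

variable {A : Type*} [Fintype A] [MeasurableSpace A] [DiscreteMeasurableSpace A]

/-- The sequences whose letters in the window `[n, m)` repeat those found `l` places before. -/
def repeatSet (A : Type*) (l n m : ℕ) : Set (ℕ → A) :=
  {x | ∀ i ∈ Finset.Ico n m, x (i - l) = x i}

theorem measurableSet_repeatSet (l n m : ℕ) : MeasurableSet (repeatSet A l n m) := by
  have : repeatSet A l n m = ⋂ i ∈ Finset.Ico n m, {x | x (i - l) = x i} := by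
    ext x
    simp [repeatSet]
  rw [this]
  exact Finset.measurableSet_biInter _ fun i _ =>
    measurableSet_eq_fun (measurable_pi_apply _) (measurable_pi_apply _)

variable [Nonempty A]

theorem bernoulli_repeatSet {l n m : ℕ} (hl : 0 < l) (hln : l ≤ n) :
    (bernoulli A).real (repeatSet A l n m) = ((Fintype.card A : ℝ)⁻¹) ^ (m - n) := by
  rw [repeatSet, bernoulli_forest (Finset.Ico n m) (fun i => i - l) (fun i => i), Nat.card_Ico]
  all_goals
    simp only [Finset.mem_Ico]
    intros
    omega

/-- Repetitions in two windows, the second of which lies after the first, are independent. -/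
theorem bernoulli_repeatSet_inter_of_le {l n m l' n' m' : ℕ} (hl : 0 < l) (hln : l ≤ n)
    (hl' : 0 < l') (hln' : l' ≤ n') (hmn : m ≤ n') :
    (bernoulli A).real (repeatSet A l n m ∩ repeatSet A l' n' m') =
      ((Fintype.card A : ℝ)⁻¹) ^ (m - n) * ((Fintype.card A : ℝ)⁻¹) ^ (m' - n') := by
  have hset : repeatSet A l n m ∩ repeatSet A l' n' m' =
      {x | ∀ i ∈ Finset.Ico n m ∪ Finset.Ico n' m',
        x (if i < m then i - l else i - l') = x i} := by
    ext x
    simp only [repeatSet, Set.mem_inter_iff, Set.mem_ofPred_eq, Finset.mem_union, Finset.mem_Ico]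
    constructor
    · rintro ⟨h1, h2⟩ i hi
      split_ifs with him
      · exact h1 i (by omega)
      · exact h2 i (by omega)
    · intro h
      refine ⟨fun i hi => ?_, fun i hi => ?_⟩
      · simpa [hi.2] using h i (Or.inl hi)
      · have := h i (Or.inr hi)
        rwa [if_neg (by omega)] at this
  have hdisj : Disjoint (Finset.Ico n m) (Finset.Ico n' m') := by
    rw [Finset.disjoint_left]
    simp only [Finset.mem_Ico]
    omega
  rw [hset, bernoulli_forest _ (fun i => if i < m then i - l else i - l') (fun i => i),
    Finset.card_union_of_disjoint hdisj, Nat.card_Ico, Nat.card_Ico, pow_add]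
  all_goals
    simp only [Finset.mem_union, Finset.mem_Ico]
    intros
    try split_ifs
    all_goals omega

/-- Repetitions with different lags are independent if the windows copied from lie before both
windows, even when the windows `[n, m)` and `[n', m')` overlap. -/
theorem bernoulli_repeatSet_inter_of_lt {l n m l' n' m' : ℕ} (hll : l' < l) (hln : l ≤ n)
    (hl' : 0 < l') (hln' : l' ≤ n') (h1 : m ≤ n + l) (h2 : m' ≤ n + l')
    (h3 : m' ≤ n' + l') :
    (bernoulli A).real (repeatSet A l n m ∩ repeatSet A l' n' m') =
      ((Fintype.card A : ℝ)⁻¹) ^ (m - n) * ((Fintype.card A : ℝ)⁻¹) ^ (m' - n') := by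
  classical
  -- The edge `{i - l, i}` gets the index `2 i`, with new position `i`; the edge `{i - l', i}` gets
  -- the index `2 i + 1`, and its new position is `i - l'` if `i` has been used already. As
  -- `l' < l`, the position `i - l'` is beyond all the positions `j - l` with `j ≤ i`.
  let top : ℕ → Prop := fun e => e % 2 = 0 ∨ ¬ (n ≤ e / 2 ∧ e / 2 < m)
  let lag : ℕ → ℕ := fun e => if e % 2 = 0 then l else l'
  let u : ℕ → ℕ := fun e => if top e then e / 2 - lag e else e / 2
  let w : ℕ → ℕ := fun e => if top e then e / 2 else e / 2 - lag e
  let I : Finset ℕ := (Finset.Ico n m).image (fun i => 2 * i) ∪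
    (Finset.Ico n' m').image (fun i => 2 * i + 1)
  have hI : ∀ e, e ∈ I ↔ (e % 2 = 0 ∧ n ≤ e / 2 ∧ e / 2 < m) ∨
      (e % 2 = 1 ∧ n' ≤ e / 2 ∧ e / 2 < m') := by
    intro e
    simp only [I, Finset.mem_union, Finset.mem_image, Finset.mem_Ico]
    constructor
    · rintro (⟨i, hi, rfl⟩ | ⟨i, hi, rfl⟩) <;> omega
    · rintro (h | h)
      · exact Or.inl ⟨e / 2, by omega, by omega⟩
      · exact Or.inr ⟨e / 2, by omega, by omega⟩
  have hset : repeatSet A l n m ∩ repeatSet A l' n' m' = {x | ∀ e ∈ I, x (u e) = x (w e)} := by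
    have hswap : ∀ (x : ℕ → A) e, x (u e) = x (w e) ↔ x (e / 2 - lag e) = x (e / 2) := by
      intro x e
      by_cases ht : top e
      · simp only [u, w, if_pos ht]
      · simp only [u, w, if_neg ht]
        exact eq_comm
    ext x
    simp only [repeatSet, Set.mem_inter_iff, Set.mem_ofPred_eq, Finset.mem_Ico, hswap, hI]
    constructor
    · rintro ⟨h1, h2⟩ e (he | he)
      · simpa only [lag, if_pos he.1] using h1 (e / 2) he.2
      · simpa only [lag, he.1, one_ne_zero, if_false] using h2 (e / 2) he.2
    · intro h
      refine ⟨fun i hi => ?_, fun i hi => ?_⟩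
      · have h' := h (2 * i) (Or.inl ⟨by omega, by omega, by omega⟩)
        simpa only [lag, Nat.mul_mod_right, if_true, Nat.mul_div_right i two_pos] using h'
      · have h' := h (2 * i + 1) (Or.inr ⟨by omega, by omega, by omega⟩)
        have e1 : (2 * i + 1) % 2 = 1 := by omega
        have e2 : (2 * i + 1) / 2 = i := by omega
        simpa only [lag, e1, e2, one_ne_zero, if_false] using h'
  have hcard : I.card = (m - n) + (m' - n') := by
    rw [Finset.card_union_of_disjoint, Finset.card_image_of_injective _ (fun a b h => by
      simpa using h), Finset.card_image_of_injective _ (fun a b h => by simpa using h),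
      Nat.card_Ico, Nat.card_Ico]
    rw [Finset.disjoint_left]
    simp only [Finset.mem_image]
    rintro _ ⟨i, _, rfl⟩ ⟨j, _, h⟩
    omega
  rw [hset, bernoulli_forest I u w, hcard, pow_add]
  · intro e he
    rw [hI] at he
    simp only [u, w, top, lag]
    split_ifs <;> omega
  · intro e he f hf hfe
    rw [hI] at he hf
    simp only [u, w, top, lag]
    split_ifs <;> omega
  · intro e he f hf hfe
    rw [hI] at he hf
    simp only [w, top, lag]
    split_ifs <;> omega

/-- Repetitions with the same lag in two overlapping windows amount to a repetition in the union of
the windows. -/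
theorem bernoulli_repeatSet_inter_same {l n m n' m' : ℕ} (hl : 0 < l) (hln : l ≤ n)
    (hn : n ≤ n') (hn' : n' ≤ m) (hm : m ≤ m') :
    (bernoulli A).real (repeatSet A l n m ∩ repeatSet A l n' m') =
      ((Fintype.card A : ℝ)⁻¹) ^ (m' - n) := by
  rw [← bernoulli_repeatSet hl hln]
  congr 1
  ext x
  simp only [repeatSet, Set.mem_inter_iff, Set.mem_ofPred_eq, Finset.mem_Ico]
  constructor
  · rintro ⟨h1, h2⟩ i hi
    by_cases him : i < m
    · exact h1 i ⟨hi.1, him⟩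
    · exact h2 i (by omega)
  · intro h
    exact ⟨fun i hi => h i (by omega), fun i hi => h i (by omega)⟩

end Repetition

/-! ### The second moment method -/

/-- Chebyshev's inequality for the number of events that occur: if the expectation of the square of
that number exceeds the square of its expectation `e` by `C * e` at most, then the probability that
no event occurs is at most `C / e`. -/
theorem measureReal_forall_notMem_le {Ω ι : Type*} [MeasurableSpace Ω] (P : Measure Ω)
    [IsProbabilityMeasure P] (I : Finset ι) (E : ι → Set Ω) (hE : ∀ i, MeasurableSet (E i)) {C : ℝ}
    (h : ∑ i ∈ I, ∑ j ∈ I, P.real (E i ∩ E j) ≤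
      (∑ i ∈ I, P.real (E i)) ^ 2 + C * ∑ i ∈ I, P.real (E i))
    (hpos : 0 < ∑ i ∈ I, P.real (E i)) :
    P.real {x | ∀ i ∈ I, x ∉ E i} ≤ C / ∑ i ∈ I, P.real (E i) := by
  set e := ∑ i ∈ I, P.real (E i) with he
  let f : ι → Ω → ℝ := fun i => (E i).indicator 1
  have hfi : ∀ i, Integrable (f i) P := fun i => (integrable_const (1 : ℝ)).indicator (hE i)
  have hff : ∀ i j, (fun x => f i x * f j x) = (E i ∩ E j).indicator 1 := by
    intro i j
    funext x
    by_cases h1 : x ∈ E i <;> by_cases h2 : x ∈ E j <;> simp [f, h1, h2]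
  have hffi : ∀ i j, Integrable (fun x => f i x * f j x) P := by
    intro i j
    rw [hff]
    exact (integrable_const (1 : ℝ)).indicator ((hE i).inter (hE j))
  have hint : ∀ i, ∫ x, f i x ∂P = P.real (E i) := fun i => integral_indicator_one (hE i)
  have hint2 : ∀ i j, ∫ x, f i x * f j x ∂P = P.real (E i ∩ E j) := by
    intro i j
    rw [hff]
    exact integral_indicator_one ((hE i).inter (hE j))
  have hexp : (fun x => (∑ i ∈ I, f i x - e) ^ 2) =
      fun x => (∑ i ∈ I, ∑ j ∈ I, f i x * f j x) - 2 * e * (∑ i ∈ I, f i x) + e ^ 2 := by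
    funext x
    rw [← Finset.sum_mul_sum]
    ring
  have hi1 : Integrable (fun x => ∑ i ∈ I, ∑ j ∈ I, f i x * f j x) P :=
    integrable_finsetSum _ fun i _ => integrable_finsetSum _ fun j _ => hffi i j
  have hi2 : Integrable (fun x => 2 * e * ∑ i ∈ I, f i x) P :=
    (integrable_finsetSum _ fun i _ => hfi i).const_mul _
  have hi3 : Integrable (fun x => (∑ i ∈ I, f i x - e) ^ 2) P := by
    rw [hexp]
    exact (hi1.sub hi2).add (integrable_const _)
  have hval : ∫ x, (∑ i ∈ I, f i x - e) ^ 2 ∂P =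
      ∑ i ∈ I, ∑ j ∈ I, P.real (E i ∩ E j) - e ^ 2 := by
    have hi12 : Integrable (fun x => (∑ i ∈ I, ∑ j ∈ I, f i x * f j x) - 2 * e * ∑ i ∈ I, f i x)
        P := hi1.sub hi2
    rw [hexp, integral_add hi12 (integrable_const _), integral_sub hi1 hi2,
      integral_finsetSum _ fun i _ => integrable_finsetSum _ fun j _ => hffi i j,
      integral_const_mul, integral_finsetSum _ fun i _ => hfi i]
    simp only [hint, integral_const, probReal_univ, smul_eq_mul, one_mul]
    rw [← he, Finset.sum_congr rfl fun i _ => integral_finsetSum _ fun j _ => hffi i j]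
    simp only [hint2]
    ring
  have hN : MeasurableSet {x | ∀ i ∈ I, x ∉ E i} := by
    have : {x | ∀ i ∈ I, x ∉ E i} = ⋂ i ∈ I, (E i)ᶜ := by
      ext x
      simp
    rw [this]
    exact Finset.measurableSet_biInter _ fun i _ => (hE i).compl
  have hlow : e ^ 2 * P.real {x | ∀ i ∈ I, x ∉ E i} ≤ ∫ x, (∑ i ∈ I, f i x - e) ^ 2 ∂P := by
    have h1 : ∫ x, {x | ∀ i ∈ I, x ∉ E i}.indicator (fun _ => e ^ 2) x ∂P =
        e ^ 2 * P.real {x | ∀ i ∈ I, x ∉ E i} := by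
      rw [integral_indicator_const _ hN, smul_eq_mul, mul_comm]
    rw [← h1]
    refine integral_mono ((integrable_const _).indicator hN) hi3 fun x => ?_
    refine Set.indicator_apply_le' (fun hx => ?_) fun _ => sq_nonneg _
    have : ∑ i ∈ I, f i x = 0 := Finset.sum_eq_zero fun i hi => by
      simp [f, hx i hi]
    simp [this]
  rw [le_div_iff₀ hpos]
  have h2 : e * (P.real {x | ∀ i ∈ I, x ∉ E i} * e) ≤ e * C := by
    rw [hval] at hlow
    linarith
  exact le_of_mul_le_mul_left h2 hpos

/-! ### Almost every sequence repeats itself -/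

section Recurrence

variable {A : Type*} [Fintype A] [MeasurableSpace A] [DiscreteMeasurableSpace A] [Nonempty A]

theorem sum_inv_pow_sub_le {r : ℝ} (h0 : 0 ≤ r) (h1 : r ≤ 1 / 2) (J : Finset ℕ) (a : ℕ) :
    ∑ m ∈ J, (if a ≤ m then r ^ (m - a) else 0) ≤ 2 := by
  classical
  rw [← Finset.sum_filter]
  have hinj : Set.InjOn (fun m => m - a) ((J.filter fun m => a ≤ m : Finset ℕ) : Set ℕ) := by
    intro x hx y hy hxy
    simp only [Finset.coe_filter, Set.mem_ofPred_eq] at hx hy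
    simp only at hxy
    omega
  rw [← Finset.sum_image (f := fun k => r ^ k) hinj]
  have hr : r < 1 := by linarith
  refine ((summable_geometric_of_lt_one h0 hr).sum_le_tsum _ fun i _ => by positivity).trans ?_
  rw [tsum_geometric_of_lt_one h0 hr]
  rw [inv_le_comm₀ (by linarith) (by norm_num)]
  linarith

/-- Probability that two repetitions occur together, for windows `[ν m, m)` that are short and
repeat letters before position `ν m / 2`: the events are independent up to a term that is present
only for equal lags, and that decays geometrically with the distance of the windows. -/
theorem bernoulli_repeatSet_inter_le {ν : ℕ → ℕ} (hmono : Monotone ν) (hle : ∀ m, ν m ≤ m)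
    {m m' k k' : ℕ} (hm : 4 * (m - ν m) ≤ ν m) (hm' : 4 * (m' - ν m') ≤ ν m')
    (hk : k < ν m / 4) (hk' : k' < ν m' / 4) (hmm : m ≤ m') :
    (bernoulli A).real (repeatSet A (ν m - k) (ν m) m ∩ repeatSet A (ν m' - k') (ν m') m') ≤
      ((Fintype.card A : ℝ)⁻¹) ^ (m - ν m) * ((Fintype.card A : ℝ)⁻¹) ^ (m' - ν m') +
      if ν m - k = ν m' - k' ∧ m ≤ m' then
        ((Fintype.card A : ℝ)⁻¹) ^ (m - ν m) * ((Fintype.card A : ℝ)⁻¹) ^ (m' - m) else 0 := by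
  have hν := hmono hmm
  have hνm := hle m
  have hνm' := hle m'
  have hpos : ∀ n : ℕ, 0 ≤ ((Fintype.card A : ℝ)⁻¹) ^ n := fun n => by positivity
  have hite : 0 ≤ if ν m - k = ν m' - k' ∧ m ≤ m' then
        ((Fintype.card A : ℝ)⁻¹) ^ (m - ν m) * ((Fintype.card A : ℝ)⁻¹) ^ (m' - m) else 0 := by
    split_ifs
    · exact mul_nonneg (hpos _) (hpos _)
    · exact le_rfl
  rcases le_or_gt m (ν m') with h | h
  · rw [bernoulli_repeatSet_inter_of_le (by omega) (by omega) (by omega) (by omega) h]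
    linarith
  rcases lt_trichotomy (ν m - k) (ν m' - k') with hl | hl | hl
  · rw [Set.inter_comm, bernoulli_repeatSet_inter_of_lt hl (by omega) (by omega) (by omega)
      (by omega) (by omega) (by omega)]
    linarith
  · rw [if_pos ⟨hl, hmm⟩, ← hl,
      bernoulli_repeatSet_inter_same (by omega) (by omega) hν h.le hmm,
      ← pow_add _ (m - ν m) (m' - m), show m - ν m + (m' - m) = m' - ν m by omega]
    linarith [mul_nonneg (hpos (m - ν m)) (hpos (m' - ν m'))]
  · rw [bernoulli_repeatSet_inter_of_lt hl (by omega) (by omega) (by omega)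
      (by omega) (by omega) (by omega)]
    linarith

/-- The probability that there is no repetition in any of the windows `[ν m, m)`, `m ∈ J`, is small
if the expected number of repetitions is large. -/
theorem bernoulli_no_repetition_le (hA : 2 ≤ Fintype.card A) {ν : ℕ → ℕ} (hmono : Monotone ν)
    (hle : ∀ m, ν m ≤ m) (J : Finset ℕ) (hJ : ∀ m ∈ J, 4 * (m - ν m) ≤ ν m) {e : ℝ}
    (he : e = ∑ m ∈ J, ((ν m / 4 : ℕ) : ℝ) * ((Fintype.card A : ℝ)⁻¹) ^ (m - ν m)) (hpos : 0 < e) :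
    (bernoulli A).real {x | ∀ m ∈ J, ∀ k < ν m / 4, x ∉ repeatSet A (ν m - k) (ν m) m} ≤
      4 / e := by
  classical
  set r : ℝ := (Fintype.card A : ℝ)⁻¹ with hr
  have hr0 : 0 ≤ r := by positivity
  have hr1 : r ≤ 1 / 2 := by
    rw [hr, one_div]
    exact inv_anti₀ (by norm_num) (by exact_mod_cast hA)
  let I : Finset ((_ : ℕ) × ℕ) := J.sigma fun m => Finset.range (ν m / 4)
  let E : ((_ : ℕ) × ℕ) → Set (ℕ → A) := fun i => repeatSet A (ν i.1 - i.2) (ν i.1) i.1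
  have hI : ∀ i, i ∈ I ↔ i.1 ∈ J ∧ i.2 < ν i.1 / 4 := by
    intro i
    simp only [I, Finset.mem_sigma, Finset.mem_range]
  have hPE : ∀ i ∈ I, (bernoulli A).real (E i) = r ^ (i.1 - ν i.1) := by
    intro i hi
    rw [hI] at hi
    exact bernoulli_repeatSet (by omega) (by omega)
  have hsum : ∑ i ∈ I, (bernoulli A).real (E i) = e := by
    rw [Finset.sum_congr rfl hPE, he, Finset.sum_sigma]
    refine Finset.sum_congr rfl fun m _ => ?_
    dsimp only
    rw [Finset.sum_const, Finset.card_range, nsmul_eq_mul]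
  let R : ((_ : ℕ) × ℕ) → ((_ : ℕ) × ℕ) → ℝ := fun i j =>
    if ν i.1 - i.2 = ν j.1 - j.2 ∧ i.1 ≤ j.1 then r ^ (i.1 - ν i.1) * r ^ (j.1 - i.1) else 0
  have hR0 : ∀ i j, 0 ≤ R i j := by
    intro i j
    simp only [R]
    split_ifs <;> positivity
  have hpair : ∀ i ∈ I, ∀ j ∈ I, (bernoulli A).real (E i ∩ E j) ≤
      r ^ (i.1 - ν i.1) * r ^ (j.1 - ν j.1) + R i j + R j i := by
    intro i hi j hj
    have hi' := (hI i).mp hi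
    have hj' := (hI j).mp hj
    rcases le_total i.1 j.1 with h | h
    · have := bernoulli_repeatSet_inter_le (A := A) hmono hle (hJ _ hi'.1) (hJ _ hj'.1) hi'.2
        hj'.2 h
      exact this.trans (le_add_of_nonneg_right (hR0 j i))
    · have := bernoulli_repeatSet_inter_le (A := A) hmono hle (hJ _ hj'.1) (hJ _ hi'.1) hj'.2
        hi'.2 h
      rw [Set.inter_comm]
      refine this.trans ?_
      have h0 := hR0 i j
      change r ^ (j.1 - ν j.1) * r ^ (i.1 - ν i.1) + R j i ≤ _
      linarith
  -- For a given lag, each window has one repetition at most.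
  have hRsum : ∀ i ∈ I, ∑ j ∈ I, R i j ≤ r ^ (i.1 - ν i.1) * 2 := by
    intro i _
    calc ∑ j ∈ I, R i j
        = ∑ m ∈ J, ∑ k ∈ Finset.range (ν m / 4), R i ⟨m, k⟩ := Finset.sum_sigma _ _ _
      _ ≤ ∑ m ∈ J, r ^ (i.1 - ν i.1) * (if i.1 ≤ m then r ^ (m - i.1) else 0) := by
          refine Finset.sum_le_sum fun m _ => ?_
          by_cases him : i.1 ≤ m
          · rw [if_pos him]
            have h1 : ∀ k ∈ Finset.range (ν m / 4), R i ⟨m, k⟩ ≤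
                if k = ν m - (ν i.1 - i.2) then r ^ (i.1 - ν i.1) * r ^ (m - i.1) else 0 := by
              intro k hk
              rw [Finset.mem_range] at hk
              simp only [R]
              split_ifs with h2 h3
              · exact le_rfl
              · omega
              · positivity
              · exact le_rfl
            refine (Finset.sum_le_sum h1).trans ?_
            rw [Finset.sum_ite_eq']
            split_ifs
            · exact le_rfl
            · positivity
          · rw [if_neg him, mul_zero]
            refine (Finset.sum_eq_zero fun k _ => ?_).le
            simp only [R]
            rw [if_neg fun h => him h.2]
      _ ≤ r ^ (i.1 - ν i.1) * 2 := by
          rw [← Finset.mul_sum]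
          exact mul_le_mul_of_nonneg_left (sum_inv_pow_sub_le hr0 hr1 J i.1) (by positivity)
  have hRtot : ∑ i ∈ I, ∑ j ∈ I, R i j ≤ e * 2 := by
    rw [← hsum, Finset.sum_congr rfl hPE, Finset.sum_mul]
    exact Finset.sum_le_sum hRsum
  have hsecond : ∑ i ∈ I, ∑ j ∈ I, (bernoulli A).real (E i ∩ E j) ≤
      (∑ i ∈ I, (bernoulli A).real (E i)) ^ 2 + 4 * ∑ i ∈ I, (bernoulli A).real (E i) := by
    calc ∑ i ∈ I, ∑ j ∈ I, (bernoulli A).real (E i ∩ E j)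
        ≤ ∑ i ∈ I, ∑ j ∈ I, (r ^ (i.1 - ν i.1) * r ^ (j.1 - ν j.1) + R i j + R j i) :=
          Finset.sum_le_sum fun i hi => Finset.sum_le_sum fun j hj => hpair i hi j hj
      _ = (∑ i ∈ I, r ^ (i.1 - ν i.1)) ^ 2 + ∑ i ∈ I, ∑ j ∈ I, R i j
            + ∑ i ∈ I, ∑ j ∈ I, R i j := by
          simp only [Finset.sum_add_distrib]
          rw [Finset.sum_comm (f := fun i j => R j i), sq, Finset.sum_mul_sum]
      _ ≤ _ := by
          rw [hsum, ← Finset.sum_congr rfl hPE, hsum]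
          linarith
  have hmeas := measureReal_forall_notMem_le (bernoulli A) I E
    (fun i => measurableSet_repeatSet _ _ _) hsecond (by rw [hsum]; exact hpos)
  rw [hsum] at hmeas
  refine le_of_eq_of_le ?_ hmeas
  congr 1
  ext x
  constructor
  · intro h i hi
    exact h i.1 ((hI i).mp hi).1 i.2 ((hI i).mp hi).2
  · intro h m hm k hk
    exact h ⟨m, k⟩ ((hI _).mpr ⟨hm, hk⟩)

theorem summable_mul_half_pow_div_five :
    Summable fun m : ℕ => (m : ℝ) * (1 / 2 : ℝ) ^ (m / 5) := by
  have h := summable_pow_mul_geometric_of_norm_lt_one (R := ℝ) 1 (r := 9 / 10) (by norm_num)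
  refine Summable.of_nonneg_of_le (fun m => by positivity) (fun m => ?_)
    (h.mul_left ((10 / 9 : ℝ) ^ 4))
  have h1 : (1 / 2 : ℝ) ^ (m / 5) ≤ ((9 / 10 : ℝ) ^ 5) ^ (m / 5) :=
    pow_le_pow_left₀ (by norm_num) (by norm_num) _
  have h2 : (9 / 10 : ℝ) ^ (5 * (m / 5) + 4) ≤ (9 / 10 : ℝ) ^ m :=
    pow_le_pow_of_le_one (by norm_num) (by norm_num) (by omega)
  rw [← pow_mul] at h1
  rw [pow_add] at h2
  have h3 : (1 / 2 : ℝ) ^ (m / 5) ≤ (10 / 9 : ℝ) ^ 4 * (9 / 10 : ℝ) ^ m := by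
    norm_num at h1 h2 ⊢
    linarith
  calc (m : ℝ) * (1 / 2 : ℝ) ^ (m / 5) ≤ m * ((10 / 9 : ℝ) ^ 4 * (9 / 10 : ℝ) ^ m) :=
        mul_le_mul_of_nonneg_left h3 (by positivity)
    _ = _ := by ring

/-- Discarding the long windows, and rounding, does not affect the divergence. -/
theorem not_summable_short_windows {ν : ℕ → ℕ} (hle : ∀ m, ν m ≤ m) {r : ℝ} (h0 : 0 ≤ r)
    (h1 : r ≤ 1 / 2) (hdiv : ¬ Summable fun m => (ν m : ℝ) * r ^ (m - ν m)) :
    ¬ Summable fun m => if 4 * (m - ν m) ≤ ν m then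
      ((ν m / 4 : ℕ) : ℝ) * r ^ (m - ν m) else 0 := by
  intro h
  refine hdiv (Summable.of_nonneg_of_le (fun m => by positivity) (fun m => ?_)
    ((h.mul_left 7).add summable_mul_half_pow_div_five))
  have hνm := hle m
  have hcast : (ν m : ℝ) ≤ m := by exact_mod_cast hνm
  by_cases hbig : 4 * (m - ν m) ≤ ν m ∧ 4 ≤ ν m
  · rw [if_pos hbig.1]
    have h2 : (ν m : ℝ) ≤ 7 * ((ν m / 4 : ℕ) : ℝ) := by
      have : ν m ≤ 7 * (ν m / 4) := by omega
      exact_mod_cast this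
    have h3 : (ν m : ℝ) * r ^ (m - ν m) ≤ 7 * ((ν m / 4 : ℕ) : ℝ) * r ^ (m - ν m) :=
      mul_le_mul_of_nonneg_right h2 (by positivity)
    have h4 : 0 ≤ (m : ℝ) * (1 / 2 : ℝ) ^ (m / 5) := by positivity
    linarith
  · have h2 : r ^ (m - ν m) ≤ (1 / 2 : ℝ) ^ (m / 5) :=
      (pow_le_pow_left₀ h0 h1 _).trans
        (pow_le_pow_of_le_one (by norm_num) (by norm_num) (by omega))
    have h3 : (ν m : ℝ) * r ^ (m - ν m) ≤ (m : ℝ) * (1 / 2 : ℝ) ^ (m / 5) :=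
      mul_le_mul hcast h2 (by positivity) (by positivity)
    refine h3.trans (le_add_of_nonneg_left ?_)
    split_ifs <;> positivity

/-- If `∑ m, ν m * #A ^ (ν m - m)` diverges, then almost every sequence has infinitely many windows
`[ν m, m)` that repeat an earlier part of the sequence. -/
theorem ae_frequently_repeatSet (hA : 2 ≤ Fintype.card A) {ν : ℕ → ℕ} (hmono : Monotone ν)
    (hle : ∀ m, ν m ≤ m)
    (hdiv : ¬ Summable fun m => (ν m : ℝ) * ((Fintype.card A : ℝ)⁻¹) ^ (m - ν m)) :
    ∀ᵐ x ∂bernoulli A, ∃ᶠ m in Filter.atTop, ∃ k < ν m,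
      x ∈ repeatSet A (ν m - k) (ν m) m := by
  classical
  set r : ℝ := (Fintype.card A : ℝ)⁻¹ with hr
  have hr0 : 0 ≤ r := by positivity
  have hr1 : r ≤ 1 / 2 := by
    rw [hr, one_div]
    exact inv_anti₀ (by norm_num) (by exact_mod_cast hA)
  have hdiv' := not_summable_short_windows hle hr0 hr1 hdiv
  have hae : ∀ K : ℕ, ∀ᵐ x ∂bernoulli A, ∃ m ≥ K, ∃ k < ν m,
      x ∈ repeatSet A (ν m - k) (ν m) m := by
    intro K
    rw [ae_iff]
    rw [← measureReal_eq_zero_iff]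
    refine le_antisymm (le_of_forall_pos_le_add fun ε hε => ?_) measureReal_nonneg
    have hK : ¬ Summable fun n => (fun m => if 4 * (m - ν m) ≤ ν m then
        ((ν m / 4 : ℕ) : ℝ) * r ^ (m - ν m) else 0) (n + K) :=
      fun h => hdiv' ((summable_nat_add_iff K).mp h)
    have hlarge : ∃ N, 4 / ε < ∑ n ∈ Finset.range N, (fun m => if 4 * (m - ν m) ≤ ν m then
        ((ν m / 4 : ℕ) : ℝ) * r ^ (m - ν m) else 0) (n + K) := by
      by_contra! hcon
      refine hK (summable_of_sum_range_le (fun n => ?_) hcon)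
      dsimp only
      split_ifs <;> positivity
    obtain ⟨N, hN⟩ := hlarge
    let J : Finset ℕ := ((Finset.range N).image fun n => n + K).filter
      fun m => 4 * (m - ν m) ≤ ν m
    have hJ : ∀ m ∈ J, 4 * (m - ν m) ≤ ν m := fun m hm => (Finset.mem_filter.mp hm).2
    have hJK : ∀ m ∈ J, K ≤ m := by
      intro m hm
      obtain ⟨n, _, rfl⟩ := Finset.mem_image.mp (Finset.mem_filter.mp hm).1
      omega
    have hsum : ∑ n ∈ Finset.range N, (fun m => if 4 * (m - ν m) ≤ ν m then
        ((ν m / 4 : ℕ) : ℝ) * r ^ (m - ν m) else 0) (n + K) =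
        ∑ m ∈ J, ((ν m / 4 : ℕ) : ℝ) * r ^ (m - ν m) := by
      rw [Finset.sum_filter, Finset.sum_image (fun a _ b _ h => by simpa using h)]
    rw [hsum] at hN
    have hpos : 0 < ∑ m ∈ J, ((ν m / 4 : ℕ) : ℝ) * r ^ (m - ν m) := lt_trans (by positivity) hN
    have hb := bernoulli_no_repetition_le hA hmono hle J hJ rfl hpos
    rw [zero_add]
    refine (measureReal_mono ?_).trans (hb.trans ?_)
    · intro x hx m hm k hk hxm
      exact hx ⟨m, hJK m hm, k, by omega, hxm⟩
    · rw [div_le_iff₀ hpos]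
      rw [div_lt_iff₀ hε] at hN
      linarith
  filter_upwards [ae_all_iff.mpr hae] with x hx
  exact Filter.frequently_atTop.mpr hx

end Recurrence

/-! ### The choice of the windows -/

section Windows

/-- The largest `n ≤ m` for which `ψ n` exceeds the distance `D * Q ^ (-m)` that corresponds to an
agreement of `m` letters, and `0` if there is none. -/
noncomputable def windowStart (D Q : ℝ) (ψ : ℕ → ℝ) (m : ℕ) : ℕ := by
  classical exact Nat.findGreatest (fun n => D * (Q⁻¹) ^ m < ψ n) m

variable {D Q : ℝ} {ψ : ℕ → ℝ}

theorem windowStart_le (m : ℕ) : windowStart D Q ψ m ≤ m := by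
  classical exact Nat.findGreatest_le m

theorem lt_of_windowStart_ne_zero {m : ℕ} (h : windowStart D Q ψ m ≠ 0) :
    D * (Q⁻¹) ^ m < ψ (windowStart D Q ψ m) := by
  classical exact Nat.findGreatest_of_ne_zero (P := fun n => D * (Q⁻¹) ^ m < ψ n) rfl h

theorem le_windowStart {n m : ℕ} (hnm : n ≤ m) (h : D * (Q⁻¹) ^ m < ψ n) :
    n ≤ windowStart D Q ψ m := by
  classical exact Nat.le_findGreatest (P := fun n => D * (Q⁻¹) ^ m < ψ n) hnm h

theorem mul_inv_pow_anti (hD : 0 < D) (hQ : 2 ≤ Q) : Antitone fun m : ℕ => D * (Q⁻¹) ^ m :=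
  fun _ _ h => mul_le_mul_of_nonneg_left
    (pow_le_pow_of_le_one (by positivity) (inv_le_one_of_one_le₀ (by linarith)) h) hD.le

theorem monotone_windowStart (hD : 0 < D) (hQ : 2 ≤ Q) : Monotone (windowStart D Q ψ) := by
  intro m m' h
  by_cases h0 : windowStart D Q ψ m = 0
  · rw [h0]
    exact Nat.zero_le _
  · exact le_windowStart ((windowStart_le m).trans h)
      ((mul_inv_pow_anti hD hQ h).trans_lt (lt_of_windowStart_ne_zero h0))

theorem sum_mul_pow_le {c : ℝ} (hc : 2 ≤ c) (N : ℕ) :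
    ∑ n ∈ Finset.range (N + 1), (n : ℝ) * c ^ n ≤ 2 * (N * c ^ N) := by
  induction N with
  | zero => simp
  | succ N ih =>
    rw [Finset.sum_range_succ]
    have h1 : 2 * ((N : ℝ) * c ^ N) ≤ ((N + 1 : ℕ) : ℝ) * c ^ (N + 1) := by
      have h2 : (N : ℝ) * c ^ N * 2 ≤ (N : ℝ) * c ^ N * c :=
        mul_le_mul_of_nonneg_left hc (by positivity)
      have h3 : 0 ≤ c ^ N * c := by positivity
      push_cast
      rw [pow_succ]
      nlinarith
    linarith

/-- If the expected number of repetitions in the windows `[windowStart m, m)` is finite, then so is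
the Khintchine sum of `ψ`. Grouping the terms `n` of the latter by the least `m` with
`D * Q ^ (-m) < ψ n`, each group is a geometric sum dominated by its last term. -/
theorem summable_of_summable_windowStart (hD : 0 < D) (hQ : 2 ≤ Q) {c s : ℝ} (hc : 2 ≤ c)
    (hs : 0 < s) (hQs : Q ^ s = c) (hψ : ∀ n, 0 < ψ n)
    (hsum : Summable fun m => (windowStart D Q ψ m : ℝ) * (c⁻¹) ^ (m - windowStart D Q ψ m)) :
    Summable fun n : ℕ => (n : ℝ) * c ^ n * ψ n ^ s := by
  classical
  have hc0 : 0 < c := by linarith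
  have hQ0 : 0 < Q := by linarith
  have hanti := mul_inv_pow_anti hD hQ
  have hex : ∀ n, ∃ m, D * (Q⁻¹) ^ m < ψ n := by
    intro n
    obtain ⟨m, hm⟩ := exists_pow_lt_of_lt_one (div_pos (hψ n) hD)
      (inv_lt_one_of_one_lt₀ (by linarith : 1 < Q))
    exact ⟨m, by rwa [lt_div_iff₀' hD] at hm⟩
  let M : ℕ → ℕ := fun n => Nat.find (hex n)
  have hM : ∀ n, D * (Q⁻¹) ^ M n < ψ n := fun n => Nat.find_spec (hex n)
  -- If `M n ≤ n`, then the window at `m = n` is empty, and its term in the convergent sum is `n`.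
  obtain ⟨N₀, hN₀⟩ : ∃ N₀, ∀ n ≥ N₀, n < M n := by
    have h1 := hsum.tendsto_atTop_zero.eventually (gt_mem_nhds (zero_lt_one (α := ℝ)))
    obtain ⟨N, hN⟩ := Filter.eventually_atTop.mp h1
    refine ⟨N + 1, fun n hn => ?_⟩
    by_contra! hcon
    have h2 : windowStart D Q ψ n = n :=
      le_antisymm (windowStart_le n) (le_windowStart le_rfl ((hanti hcon).trans_lt (hM n)))
    have h3 := hN n (by omega)
    rw [h2, Nat.sub_self, pow_zero, mul_one] at h3
    have h4 : (1 : ℝ) ≤ n := by exact_mod_cast (by omega : 1 ≤ n)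
    linarith
  have hterm : ∀ n ≥ N₀, ψ n ^ s ≤ D ^ s * c * (c⁻¹) ^ M n := by
    intro n hn
    have hMn := hN₀ n hn
    obtain ⟨k, hk⟩ : ∃ k, M n = k + 1 := ⟨M n - 1, by omega⟩
    have h1 : ψ n ≤ D * (Q⁻¹) ^ k := not_lt.mp (Nat.find_min (hex n) (by
      change k < M n
      omega))
    calc ψ n ^ s ≤ (D * (Q⁻¹) ^ k) ^ s := Real.rpow_le_rpow (hψ n).le h1 hs.le
      _ = D ^ s * (c⁻¹) ^ k := by
          rw [Real.mul_rpow hD.le (by positivity), ← Real.rpow_pow_comm (by positivity),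
            Real.inv_rpow hQ0.le, hQs]
      _ = D ^ s * c * (c⁻¹) ^ M n := by
          rw [hk, pow_succ]
          field_simp
  rw [← summable_nat_add_iff N₀]
  refine summable_of_sum_range_le (c := D ^ s * c * (2 * ∑' m, (windowStart D Q ψ m : ℝ) *
    (c⁻¹) ^ (m - windowStart D Q ψ m))) (fun n => ?_) fun N => ?_
  · have := (hψ (n + N₀)).le
    positivity
  let T := Finset.Ico N₀ (N + N₀)
  obtain ⟨L, hL⟩ : ∃ L, ∀ n ∈ T, M n < L :=
    ⟨T.sup M + 1, fun n hn => Nat.lt_succ_of_le (Finset.le_sup hn)⟩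
  have hnonneg : ∀ n m : ℕ, 0 ≤ if n ≤ windowStart D Q ψ m then
      (n : ℝ) * c ^ n * (c⁻¹) ^ m else 0 := by
    intro n m
    split_ifs <;> positivity
  calc ∑ n ∈ Finset.range N, ((n + N₀ : ℕ) : ℝ) * c ^ (n + N₀) * ψ (n + N₀) ^ s
      = ∑ n ∈ T, (n : ℝ) * c ^ n * ψ n ^ s := by
        rw [Finset.sum_Ico_eq_sum_range, Nat.add_sub_cancel]
        simp only [add_comm N₀]
    _ ≤ ∑ n ∈ T, D ^ s * c * ∑ m ∈ Finset.range L, (if n ≤ windowStart D Q ψ m then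
          (n : ℝ) * c ^ n * (c⁻¹) ^ m else 0) := by
        refine Finset.sum_le_sum fun n hn => ?_
        have hn0 : N₀ ≤ n := (Finset.mem_Ico.mp hn).1
        have h1 : (n : ℝ) * c ^ n * (c⁻¹) ^ M n ≤ ∑ m ∈ Finset.range L,
            (if n ≤ windowStart D Q ψ m then (n : ℝ) * c ^ n * (c⁻¹) ^ m else 0) := by
          refine le_trans ?_ (Finset.single_le_sum (fun m _ => hnonneg n m)
            (Finset.mem_range.mpr (hL n hn)))
          rw [if_pos (le_windowStart (hN₀ n hn0).le (hM n))]
        calc (n : ℝ) * c ^ n * ψ n ^ s ≤ (n : ℝ) * c ^ n * (D ^ s * c * (c⁻¹) ^ M n) :=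
              mul_le_mul_of_nonneg_left (hterm n hn0) (by positivity)
          _ = D ^ s * c * ((n : ℝ) * c ^ n * (c⁻¹) ^ M n) := by ring
          _ ≤ _ := mul_le_mul_of_nonneg_left h1 (by positivity)
    _ = D ^ s * c * ∑ m ∈ Finset.range L, ∑ n ∈ T, (if n ≤ windowStart D Q ψ m then
          (n : ℝ) * c ^ n * (c⁻¹) ^ m else 0) := by
        rw [← Finset.mul_sum, Finset.sum_comm]
    _ ≤ D ^ s * c * ∑ m ∈ Finset.range L, 2 * ((windowStart D Q ψ m : ℝ) *
          (c⁻¹) ^ (m - windowStart D Q ψ m)) := by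
        refine mul_le_mul_of_nonneg_left (Finset.sum_le_sum fun m _ => ?_) (by positivity)
        set w := windowStart D Q ψ m with hw
        have hwm : w ≤ m := windowStart_le m
        calc ∑ n ∈ T, (if n ≤ w then (n : ℝ) * c ^ n * (c⁻¹) ^ m else 0)
            ≤ ∑ n ∈ Finset.range (w + 1), (n : ℝ) * c ^ n * (c⁻¹) ^ m := by
              rw [← Finset.sum_filter]
              refine Finset.sum_le_sum_of_subset_of_nonneg (fun n hn => ?_) fun n _ _ => by
                positivity
              rw [Finset.mem_range]
              exact Nat.lt_succ_of_le (Finset.mem_filter.mp hn).2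
          _ = (∑ n ∈ Finset.range (w + 1), (n : ℝ) * c ^ n) * (c⁻¹) ^ m := by
              rw [Finset.sum_mul]
          _ ≤ 2 * (w * c ^ w) * (c⁻¹) ^ m :=
              mul_le_mul_of_nonneg_right (sum_mul_pow_le hc w) (by positivity)
          _ = 2 * (w * (c⁻¹) ^ (m - w)) := by
              have h1 : (c⁻¹) ^ m = (c⁻¹) ^ (m - w) * (c⁻¹) ^ w := by
                rw [← pow_add, Nat.sub_add_cancel hwm]
              rw [h1, inv_pow c w]
              field_simp
    _ ≤ _ := by
        rw [← Finset.mul_sum]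
        refine mul_le_mul_of_nonneg_left (mul_le_mul_of_nonneg_left
          (hsum.sum_le_tsum _ fun m _ => by positivity) (by norm_num)) (by positivity)

end Windows

/-! ### Codings and rational points -/

section Coding

variable {d : ℕ} {A : Type*} [Fintype A]

theorem intVec_add (m n : Fin d → ℤ) : intVec (m + n) = intVec m + intVec n := by
  ext i
  simp [intVec]

theorem intVec_sub (m n : Fin d → ℤ) : intVec (m - n) = intVec m - intVec n := by
  ext i
  simp [intVec]

theorem intVec_smul (k : ℤ) (m : Fin d → ℤ) : intVec (k • m) = (k : ℝ) • intVec m := by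
  ext i
  simp [intVec]

/-- The integer vector given by the first `m` letters: `∑ i < m, p_{x_i} q ^ (m - 1 - i)`. -/
def prefixVec (p : A → Fin d → ℤ) (q : ℤ) (x : ℕ → A) (m : ℕ) : Fin d → ℤ :=
  ∑ i ∈ Finset.range m, q ^ (m - 1 - i) • p (x i)

theorem pow_smul_coding (p : A → Fin d → ℤ) {q : ℤ} (hq : 2 ≤ q.natAbs) (x : ℕ → A) (m : ℕ) :
    (q : ℝ) ^ m • coding p q x =
      intVec (prefixVec p q x m) + coding p q fun i => x (i + m) := by
  have hq0 : (q : ℝ) ≠ 0 := by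
    have : q ≠ 0 := by rintro rfl; simp at hq
    exact_mod_cast this
  have hsum : intVec (prefixVec p q x m) =
      ∑ i ∈ Finset.range m, intVec (q ^ (m - 1 - i) • p (x i)) := by
    let f : (Fin d → ℤ) →+ EuclideanSpace ℝ (Fin d) := AddMonoidHom.mk' intVec intVec_add
    exact map_sum f _ _
  have h := (summable_coding p hq x).sum_add_tsum_nat_add m
  rw [coding, ← h, smul_add, hsum, Finset.smul_sum]
  congr 1
  · refine Finset.sum_congr rfl fun i hi => ?_
    have hi' := Finset.mem_range.mp hi
    rw [intVec_smul, smul_smul]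
    congr 1
    push_cast
    have e : m = (m - 1 - i) + (i + 1) := by omega
    conv_lhs => rw [e]
    rw [pow_add, mul_assoc, ← mul_pow, mul_inv_cancel₀ hq0, one_pow, mul_one]
  · have hs : Summable fun i => ((q : ℝ)⁻¹) ^ (i + m + 1) • intVec (p (x (i + m))) :=
      (summable_nat_add_iff m (f := fun n => ((q : ℝ)⁻¹) ^ (n + 1) • intVec (p (x n)))).mpr
        (summable_coding p hq x)
    rw [← hs.tsum_const_smul, coding]
    congr 1
    funext i
    rw [smul_smul]
    congr 1
    rw [show i + m + 1 = m + (i + 1) by omega, pow_add, ← mul_assoc, ← mul_pow,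
      mul_inv_cancel₀ hq0, one_pow, one_mul]

theorem norm_intCast_eq_natAbs (q : ℤ) : ‖(q : ℝ)‖ = (q.natAbs : ℝ) := by
  rw [Real.norm_eq_abs, Nat.cast_natAbs, Int.cast_abs]

/-- Sequences that agree up to position `m` have codings at distance `O(|q| ^ (-m))`. -/
theorem exists_dist_coding_le [Nonempty A] (p : A → Fin d → ℤ) {q : ℤ} (hq : 2 ≤ q.natAbs) :
    ∃ D : ℝ, 0 < D ∧ ∀ (x y : ℕ → A) (m : ℕ), (∀ i < m, x i = y i) →
      ‖coding p q x - coding p q y‖ ≤ D * ((q.natAbs : ℝ)⁻¹) ^ m := by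
  obtain ⟨B, hB⟩ := (isSelfSimilarSet_range_coding p hq).2.1.isBounded.exists_norm_le
  have hB' : ∀ x, ‖coding p q x‖ ≤ B := fun x => hB _ ⟨x, rfl⟩
  have hB0 : 0 ≤ B := (norm_nonneg _).trans (hB' fun _ => Classical.arbitrary A)
  have hQ : (0 : ℝ) < q.natAbs := by linarith [one_lt_natAbs_cast hq]
  refine ⟨2 * B + 1, by linarith, fun x y m hxy => ?_⟩
  have hpre : prefixVec p q x m = prefixVec p q y m :=
    Finset.sum_congr rfl fun i hi => by rw [hxy i (Finset.mem_range.mp hi)]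
  have h : (q : ℝ) ^ m • (coding p q x - coding p q y) =
      coding p q (fun i => x (i + m)) - coding p q fun i => y (i + m) := by
    rw [smul_sub, pow_smul_coding p hq, pow_smul_coding p hq, hpre, add_sub_add_left_eq_sub]
  have h2 : (q.natAbs : ℝ) ^ m * ‖coding p q x - coding p q y‖ ≤ 2 * B + 1 := by
    rw [← norm_intCast_eq_natAbs, ← norm_pow, ← norm_smul, h]
    refine (norm_sub_le _ _).trans ?_
    linarith [hB' fun i => x (i + m), hB' fun i => y (i + m)]
  rw [inv_pow, ← div_eq_mul_inv, le_div_iff₀' (by positivity)]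
  exact h2

/-- Reduction to lowest terms: a point with an integer multiple `N` is a rational vector in reduced
form with denominator `N` at most. -/
theorem exists_isReduced_of_smul_eq {z : EuclideanSpace ℝ (Fin d)} {N : ℕ} (hN : 1 ≤ N)
    {v : Fin d → ℤ} (h : (N : ℝ) • z = intVec v) :
    ∃ m n, IsReduced m n ∧ n ≤ N ∧ ratVec m n = z := by
  classical
  have hex : ∃ n : ℕ, 1 ≤ n ∧ ∃ w : Fin d → ℤ, (n : ℝ) • z = intVec w := ⟨N, hN, v, h⟩
  obtain ⟨hn, w, hw⟩ := Nat.find_spec hex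
  have hmin : ∀ n' : ℕ, 1 ≤ n' → ∀ w' : Fin d → ℤ, (n' : ℝ) • z = intVec w' →
      Nat.find hex ≤ n' := fun n' h1 w' h2 => Nat.find_min' hex ⟨h1, w', h2⟩
  set n := Nat.find hex with hn_def
  refine ⟨w, n, ⟨hn, fun k hk hkw => ?_⟩, hmin N hN v h, ?_⟩
  · obtain ⟨j, hj⟩ := hk
    choose w' hw' using hkw
    have hk0 : 0 < k := Nat.pos_of_ne_zero fun h0 => by simp [h0] at hj; omega
    have hj0 : 0 < j := Nat.pos_of_ne_zero fun h0 => by simp [h0] at hj; omega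
    have hkR : (k : ℝ) ≠ 0 := by exact_mod_cast hk0.ne'
    have hww : w = (k : ℤ) • w' := by
      funext i
      simpa using hw' i
    have h3 : (j : ℝ) • z = intVec w' := by
      refine smul_right_injective _ hkR ?_
      change (k : ℝ) • (j : ℝ) • z = (k : ℝ) • intVec w'
      rw [smul_smul, ← Nat.cast_mul, ← hj, hw, hww, intVec_smul, Int.cast_natCast]
    have h4 := hmin j hj0 w' h3
    by_contra hk1
    have : 2 * j ≤ k * j := Nat.mul_le_mul_right j (by omega)
    omega
  · have hnR : (n : ℝ) ≠ 0 := by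
      have : n ≠ 0 := by omega
      exact_mod_cast this
    rw [ratVec, ← hw, smul_smul, inv_mul_cancel₀ hnR, one_smul]

/-- The coding of a sequence that is periodic with period `l` from position `k` on is a rational
vector with denominator at most `|q| ^ (k + l + 1)`. -/
theorem exists_isReduced_of_periodic (p : A → Fin d → ℤ) {q : ℤ} (hq : 2 ≤ q.natAbs) {y : ℕ → A}
    {k l : ℕ} (hl : 0 < l) (hy : ∀ i, k ≤ i → y (i + l) = y i) :
    ∃ m n, IsReduced m n ∧ n ≤ q.natAbs ^ (k + l + 1) ∧ ratVec m n = coding p q y := by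
  have hshift : (fun i => y (i + (k + l))) = fun i => y (i + k) := by
    funext i
    rw [← hy (i + k) (by omega)]
    congr 1
    omega
  let a : ℤ := q ^ (k + l) - q ^ k
  let v : Fin d → ℤ := prefixVec p q y (k + l) - prefixVec p q y k
  have ha : (a : ℝ) • coding p q y = intVec v := by
    have h1 := pow_smul_coding p hq y (k + l)
    have h2 := pow_smul_coding p hq y k
    rw [hshift] at h1
    simp only [a, v, intVec_sub]
    push_cast
    rw [sub_smul, h1, h2, add_sub_add_right_eq_sub]
  have habs : (q ^ (k + l)).natAbs = q.natAbs ^ (k + l) := Int.natAbs_pow _ _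
  have habs' : (q ^ k).natAbs = q.natAbs ^ k := Int.natAbs_pow _ _
  have hlt : q.natAbs ^ k < q.natAbs ^ (k + l) := Nat.pow_lt_pow_right hq (by omega)
  have h2 : 2 * q.natAbs ^ (k + l) ≤ q.natAbs ^ (k + l + 1) := by
    rw [pow_succ, mul_comm]
    exact Nat.mul_le_mul_left _ hq
  have hN : 1 ≤ a.natAbs := by
    have : a ≠ 0 := by
      intro h0
      have h3 : q ^ (k + l) = q ^ k := sub_eq_zero.mp h0
      rw [← habs, ← habs', h3] at hlt
      exact hlt.false
    omega
  have hNle : a.natAbs ≤ q.natAbs ^ (k + l + 1) := by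
    have h3 : a.natAbs ≤ (q ^ (k + l)).natAbs + (q ^ k).natAbs := Int.natAbs_sub_le _ _
    omega
  obtain ⟨w, hw⟩ : ∃ w, (a.natAbs : ℝ) • coding p q y = intVec w := by
    rcases Int.natAbs_eq a with h | h
    · refine ⟨v, ?_⟩
      rw [← ha]
      congr 1
      conv_rhs => rw [h]
      simp
    · refine ⟨(-1 : ℤ) • v, ?_⟩
      rw [intVec_smul, ← ha, smul_smul]
      congr 1
      conv_rhs => rw [h]
      simp
  obtain ⟨m, n, h3, h4, h5⟩ := exists_isReduced_of_smul_eq hN hw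
  exact ⟨m, n, h3, h4.trans hNle, h5⟩

/-- The sequence that follows `x` up to position `n` and from there on repeats the `l` letters
before position `n` periodically (for `0 < l ≤ n`). -/
def periodize {A : Type*} (x : ℕ → A) (n l : ℕ) : ℕ → A
  | i => if i < n ∨ l = 0 ∨ i < l then x i else periodize x n l (i - l)
termination_by i => i
decreasing_by omega

theorem periodize_add {A : Type*} (x : ℕ → A) {n l k : ℕ} (hl : 0 < l) (hn : k + l = n) (i : ℕ)
    (hi : k ≤ i) : periodize x n l (i + l) = periodize x n l i := by
  rw [periodize, if_neg (by omega), Nat.add_sub_cancel]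

/-- If the window `[n, m)` of `x` repeats the letters `l` places before, then `x` agrees up to
position `m` with its periodic continuation from position `n` on. -/
theorem periodize_eq {A : Type*} {x : ℕ → A} {n l m : ℕ} (hx : x ∈ repeatSet A l n m) (i : ℕ)
    (hi : i < m) : periodize x n l i = x i := by
  induction i using Nat.strong_induction_on with
  | _ i ih =>
    rw [periodize]
    split_ifs with h
    · rfl
    · rw [ih (i - l) (by omega) (by omega)]
      exact hx i (Finset.mem_Ico.mpr ⟨by omega, hi⟩)

end Coding

/-! ### The self-similar measure -/

section SelfSimilarMeasure

variable {d : ℕ} {A : Type*} [Fintype A]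

theorem measurable_coding [MeasurableSpace A] [DiscreteMeasurableSpace A] (p : A → Fin d → ℤ)
    {q : ℤ} (hq : 2 ≤ q.natAbs) : Measurable (coding p q) := by
  let : TopologicalSpace A := ⊥
  have : DiscreteTopology A := ⟨rfl⟩
  have : BorelSpace A := ⟨by
    rw [borel_eq_top_of_discrete]
    exact top_unique fun _ _ => MeasurableSet.of_discrete⟩
  exact (continuous_coding p hq).measurable

variable [Nonempty A]

theorem selfSimilarSet_eq_range (p : A → Fin d → ℤ) (q : ℤ) (hq : 2 ≤ q.natAbs) :
    selfSimilarSet p q hq = Set.range (coding p q) :=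
  (existsUnique_isSelfSimilarSet p hq).unique (existsUnique_isSelfSimilarSet p hq).choose_spec.1
    (isSelfSimilarSet_range_coding p hq)

/-- The self-similar measure is the distribution of the coding of a random sequence. -/
theorem selfSimilarMeasure_eq_map [MeasurableSpace A] [DiscreteMeasurableSpace A]
    (p : A → Fin d → ℤ) (q : ℤ) (hq : 2 ≤ q.natAbs) :
    selfSimilarMeasure p q hq = (bernoulli A).map (coding p q) := by
  have hcm := measurable_coding p hq
  refine (existsUnique_isSelfSimilarMeasure p hq).unique
    (existsUnique_isSelfSimilarMeasure p hq).choose_spec.1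
    ⟨Measure.isProbabilityMeasure_map hcm.aemeasurable, ?_⟩
  have h := map_consSeq_prod_infinitePi (uniformMeasure A)
  change ((uniformMeasure A).prod (bernoulli A)).map consSeq = bernoulli A at h
  ext S hS
  have hS' := hcm hS
  rw [Measure.map_apply hcm hS]
  conv_lhs => rw [← h]
  rw [Measure.map_apply measurable_consSeq hS', Measure.prod_apply (measurable_consSeq hS')]
  simp only [uniformMeasure, lintegral_finsetSum_measure, lintegral_smul_measure, lintegral_dirac,
    Measure.coe_finsetSum, Finset.sum_apply, Measure.smul_apply, naturalWeight_eq hq]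
  refine Finset.sum_congr rfl fun a _ => ?_
  rw [Measure.map_apply (continuous_ifsMap p q a).measurable hS,
    Measure.map_apply hcm ((continuous_ifsMap p q a).measurable hS)]
  congr 2
  ext i
  simp only [Set.mem_preimage, coding_consSeq p hq]

theorem measureReal_singleton_eq {p : A → Fin d → ℤ} {q : ℤ} (hq : 2 ≤ q.natAbs)
    {μ : Measure (EuclideanSpace ℝ (Fin d))}
    (hμ : IsSelfSimilarMeasure (ifsMap p q) (naturalWeight A q) μ)
    (z : EuclideanSpace ℝ (Fin d)) :
    (Fintype.card A : ℝ) * μ.real {z} = ∑ a, μ.real {(q : ℝ) • z - intVec (p a)} := by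
  have := hμ.1
  have hq0 : (q : ℝ) ≠ 0 := by
    have : q ≠ 0 := by rintro rfl; simp at hq
    exact_mod_cast this
  have hpre : ∀ a, ifsMap p q a ⁻¹' {z} = {(q : ℝ) • z - intVec (p a)} := by
    intro a
    ext x
    simp only [Set.mem_preimage, Set.mem_singleton_iff, ifsMap]
    rw [inv_smul_eq_iff₀ hq0, eq_sub_iff_add_eq]
  have h1 : μ {z} = ∑ a, ((Fintype.card A : ℝ≥0∞))⁻¹ * μ {(q : ℝ) • z - intVec (p a)} := by
    conv_lhs => rw [hμ.2]
    simp only [naturalWeight_eq hq, Measure.coe_finsetSum, Finset.sum_apply, Measure.smul_apply,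
      smul_eq_mul]
    refine Finset.sum_congr rfl fun a _ => ?_
    rw [Measure.map_apply (continuous_ifsMap p q a).measurable (measurableSet_singleton z), hpre]
  have h2 : μ.real {z} = ∑ a, (Fintype.card A : ℝ)⁻¹ * μ.real {(q : ℝ) • z - intVec (p a)} := by
    rw [measureReal_def, h1, ENNReal.toReal_sum fun a _ =>
      ENNReal.mul_ne_top (by simp) (measure_ne_top _ _)]
    simp [measureReal_def]
  have hc : (Fintype.card A : ℝ) ≠ 0 := by exact_mod_cast Fintype.card_ne_zero
  rw [h2, ← Finset.mul_sum, mul_inv_cancel_left₀ hc]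

/-- A self-similar measure of an IFS with two different maps has no atoms: the finite set of atoms
of maximal mass would be mapped into itself by the expanding maps `z ↦ q z - p_a`, and so it would
be a single point, fixed by all of these maps. -/
theorem measure_singleton_eq_zero {p : A → Fin d → ℤ} {q : ℤ} (hq : 2 ≤ q.natAbs)
    (hp : ∃ a b : A, p a ≠ p b) {μ : Measure (EuclideanSpace ℝ (Fin d))}
    (hμ : IsSelfSimilarMeasure (ifsMap p q) (naturalWeight A q) μ)
    (z₀ : EuclideanSpace ℝ (Fin d)) : μ {z₀} = 0 := by
  have := hμ.1
  by_contra hz₀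
  have hfin : {z | μ {z₀} ≤ μ {z}}.Finite :=
    Measure.finite_const_le_meas_of_disjoint_iUnion μ (pos_iff_ne_zero.mpr hz₀)
      (fun z => measurableSet_singleton z)
      (fun x y hxy => Set.disjoint_singleton.mpr hxy) (measure_ne_top _ _)
  have hfin' : {z | μ.real {z₀} ≤ μ.real {z}}.Finite := by
    refine hfin.subset fun z hz => ?_
    exact (ENNReal.toReal_le_toReal (measure_ne_top _ _) (measure_ne_top _ _)).mp hz
  obtain ⟨z₁, hz₁, hmax⟩ := Set.exists_max_image _ (fun z => μ.real {z}) hfin'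
    ⟨z₀, le_refl (μ.real {z₀})⟩
  have hle : ∀ z, μ.real {z} ≤ μ.real {z₁} := by
    intro z
    rcases le_total (μ.real {z₀}) (μ.real {z}) with h | h
    · exact hmax z h
    · exact h.trans hz₁
  let Z : Set (EuclideanSpace ℝ (Fin d)) := {z | μ.real {z} = μ.real {z₁}}
  have hZfin : Z.Finite := hfin'.subset fun z (hz : μ.real {z} = μ.real {z₁}) => by
    change μ.real {z₀} ≤ μ.real {z}
    rw [hz]
    exact hz₁
  have hZ : ∀ z ∈ Z, ∀ a, (q : ℝ) • z - intVec (p a) ∈ Z := by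
    intro z hz a
    have h1 : ∑ a, μ.real {(q : ℝ) • z - intVec (p a)} = ∑ _a : A, μ.real {z₁} := by
      rw [← measureReal_singleton_eq hq hμ, Finset.sum_const, Finset.card_univ, nsmul_eq_mul,
        show μ.real {z} = μ.real {z₁} from hz]
    exact (Finset.sum_eq_sum_iff_of_le fun a _ => hle _).mp h1 a (Finset.mem_univ a)
  obtain ⟨⟨x, y⟩, hxy, hdist⟩ := Set.exists_max_image (Z ×ˢ Z) (fun w => dist w.1 w.2)
    (hZfin.prod hZfin) ⟨(z₁, z₁), rfl, rfl⟩
  obtain ⟨a, b, hab⟩ := hp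
  have h1 := hdist (_, _) ⟨hZ x hxy.1 a, hZ y hxy.2 a⟩
  simp only [dist_sub_right, dist_smul₀, norm_intCast_eq_natAbs] at h1
  have h2 := one_lt_natAbs_cast hq
  have h3 : dist x y = 0 := by
    have := dist_nonneg (x := x) (y := y)
    nlinarith
  have hz₁Z : z₁ ∈ Z := rfl
  have h4 := hdist (_, _) ⟨hZ z₁ hz₁Z a, hZ z₁ hz₁Z b⟩
  simp only [h3] at h4
  have h5 : intVec (p a) = intVec (p b) := sub_right_injective (dist_le_zero.mp h4)
  refine hab (funext fun i => ?_)
  have h6 := congrArg (fun v : EuclideanSpace ℝ (Fin d) => v i) h5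
  simpa [intVec] using h6

end SelfSimilarMeasure

/-! ### The well approximable points -/

section WellApproximable

variable {d : ℕ}

theorem measurableSet_wellApproximable {X : Set (EuclideanSpace ℝ (Fin d))}
    (hX : MeasurableSet X) (Ψ : ℕ → ℝ≥0) : MeasurableSet (wellApproximable X Ψ) := by
  have h : wellApproximable X Ψ = X ∩ ⋂ T : Finset ((Fin d → ℤ) × ℕ),
      ⋃ mn : {mn : (Fin d → ℤ) × ℕ // mn ∉ T ∧ IsReduced mn.1 mn.2 ∧ ratVec mn.1 mn.2 ∈ X},
        {x | ‖x - ratVec mn.1.1 mn.1.2‖ < (Ψ mn.1.2 : ℝ)} := by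
    ext x
    simp only [wellApproximable, Set.mem_ofPred_eq, Set.mem_inter_iff, Set.mem_iInter,
      Set.mem_iUnion]
    refine and_congr_right fun _ => ⟨fun hinf T => ?_, fun hT hfin => ?_⟩
    · obtain ⟨mn, hmn, hmnT⟩ := hinf.exists_notMem_finset T
      exact ⟨⟨mn, hmnT, hmn.1, hmn.2.1⟩, hmn.2.2⟩
    · obtain ⟨⟨mn, hmnT, h1, h2⟩, h3⟩ := hT hfin.toFinset
      exact hmnT (hfin.mem_toFinset.mpr ⟨h1, h2, h3⟩)
  rw [h]
  refine hX.inter (MeasurableSet.iInter fun T => MeasurableSet.iUnion fun mn => ?_)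
  exact measurableSet_lt (by fun_prop) measurable_const

variable {A : Type*} [Fintype A]

/-- If infinitely many windows `[windowStart m, m)` of `x` repeat an earlier part of `x`, then the
corresponding eventually periodic sequences have rational codings that are close to that of `x`;
these are infinitely many if the coding of `x` is irrational, because the distances tend to `0`. -/
theorem coding_mem_wellApproximable (p : A → Fin d → ℤ) {q : ℤ} (hq : 2 ≤ q.natAbs)
    {Ψ : ℕ → ℝ≥0} (hΨ : AntitoneOn Ψ (Set.Ici 1)) {D : ℝ}
    (hD : ∀ (x y : ℕ → A) (m : ℕ), (∀ i < m, x i = y i) →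
      ‖coding p q x - coding p q y‖ ≤ D * ((q.natAbs : ℝ)⁻¹) ^ m)
    {ν : ℕ → ℕ} (hν : ν = windowStart D q.natAbs fun n => (Ψ (q.natAbs ^ (n + 1)) : ℝ))
    {x : ℕ → A} (hx : ∃ᶠ m in Filter.atTop, ∃ k < ν m, x ∈ repeatSet A (ν m - k) (ν m) m)
    (hirr : ∀ mn : (Fin d → ℤ) × ℕ, coding p q x ≠ ratVec mn.1 mn.2) :
    coding p q x ∈ wellApproximable (Set.range (coding p q)) Ψ := by
  refine ⟨⟨x, rfl⟩, fun hfin => ?_⟩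
  obtain ⟨δ, hδ, hδle⟩ : ∃ δ > 0, ∀ mn ∈ hfin.toFinset,
      δ ≤ ‖coding p q x - ratVec mn.1 mn.2‖ := by
    have hpos : ∀ mn : (Fin d → ℤ) × ℕ, 0 < ‖coding p q x - ratVec mn.1 mn.2‖ :=
      fun mn => norm_pos_iff.mpr (sub_ne_zero.mpr (hirr mn))
    rcases hfin.toFinset.eq_empty_or_nonempty with h | h
    · exact ⟨1, one_pos, fun mn hmn => absurd (h ▸ hmn) (Finset.notMem_empty mn)⟩
    · obtain ⟨mn, -, hmn⟩ := hfin.toFinset.exists_min_image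
        (fun mn => ‖coding p q x - ratVec mn.1 mn.2‖) h
      exact ⟨_, hpos mn, hmn⟩
  have hQ := one_lt_natAbs_cast hq
  have hlim : Filter.Tendsto (fun m : ℕ => D * ((q.natAbs : ℝ)⁻¹) ^ m) Filter.atTop (nhds 0) := by
    simpa using (tendsto_pow_atTop_nhds_zero_of_lt_one (by positivity)
      (inv_lt_one_of_one_lt₀ hQ)).const_mul D
  obtain ⟨m, ⟨k, hk, hrep⟩, hm⟩ := (hx.and_eventually (hlim.eventually (gt_mem_nhds hδ))).exists
  let y := periodize x (ν m) (ν m - k)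
  obtain ⟨v, n, hred, hn, hvn⟩ := exists_isReduced_of_periodic p hq (y := y) (k := k)
    (l := ν m - k) (by omega)
    (fun i hi => periodize_add x (by omega) (by omega) i hi)
  rw [show k + (ν m - k) + 1 = ν m + 1 by omega] at hn
  have hclose := hD x y m fun i hi => (periodize_eq hrep i hi).symm
  have hlt : D * ((q.natAbs : ℝ)⁻¹) ^ m < Ψ (q.natAbs ^ (ν m + 1)) := by
    have h0 : ν m ≠ 0 := by omega
    rw [hν] at h0 ⊢
    exact lt_of_windowStart_ne_zero h0
  have hanti : Ψ (q.natAbs ^ (ν m + 1)) ≤ Ψ n :=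
    hΨ hred.1 (hred.1.trans hn) hn
  have hmem : (v, n) ∈ hfin.toFinset := by
    rw [hfin.mem_toFinset]
    refine ⟨hred, ⟨y, hvn.symm⟩, ?_⟩
    rw [hvn]
    exact (hclose.trans_lt hlt).trans_le (by exact_mod_cast hanti)
  have h := hδle _ hmem
  rw [hvn] at h
  exact absurd (h.trans hclose) (not_le.mpr hm)

/-- The divergence hypothesis, in terms of real series and for the values `Ψ (|q| ^ (n + 1))`. -/
theorem pos_and_not_summable_of_tsum_eq_top {Q c : ℕ} (hQ : 2 ≤ Q) (hc : 2 ≤ c) {s : ℝ}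
    (hs : 0 < s) {Ψ : ℕ → ℝ≥0} (hΨ : AntitoneOn Ψ (Set.Ici 1))
    (hdiv : ∑' n : ℕ, (((n : ℝ≥0) * (c : ℝ≥0) ^ n * Ψ (Q ^ n) ^ s : ℝ≥0) : ℝ≥0∞) = ⊤) :
    (∀ n, 0 < (Ψ (Q ^ (n + 1)) : ℝ)) ∧
      ¬ Summable fun n : ℕ => (n : ℝ) * (c : ℝ) ^ n * (Ψ (Q ^ (n + 1)) : ℝ) ^ s := by
  have hns : ¬ Summable fun n : ℕ => (n : ℝ) * (c : ℝ) ^ n * (Ψ (Q ^ n) : ℝ) ^ s := by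
    intro h
    refine ENNReal.tsum_coe_ne_top_iff_summable.mpr ?_ hdiv
    rw [← NNReal.summable_coe]
    simpa using h
  refine ⟨fun n => ?_, fun h => hns ?_⟩
  · by_contra hcon
    have h0 : Ψ (Q ^ (n + 1)) = 0 := by
      have : (Ψ (Q ^ (n + 1)) : ℝ) = 0 := le_antisymm (not_lt.mp hcon) (NNReal.coe_nonneg _)
      exact_mod_cast this
    refine hns ((summable_nat_add_iff (n + 1)).mp ?_)
    refine summable_zero.congr fun j => ?_
    have h1 : Ψ (Q ^ (j + (n + 1))) ≤ Ψ (Q ^ (n + 1)) :=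
      hΨ (Nat.one_le_pow _ _ (by omega)) (Nat.one_le_pow _ _ (by omega))
        (Nat.pow_le_pow_right (by omega) (by omega))
    rw [h0] at h1
    rw [le_antisymm h1 zero_le, NNReal.coe_zero, Real.zero_rpow hs.ne', mul_zero]
  · refine (summable_nat_add_iff 2).mp ?_
    refine Summable.of_nonneg_of_le (fun n => by positivity) (fun n => ?_)
      (((summable_nat_add_iff 1).mpr h).mul_left (2 * (c : ℝ)))
    have hX : 0 ≤ (c : ℝ) ^ (n + 1) * c * (Ψ (Q ^ (n + 1 + 1)) : ℝ) ^ s := by positivity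
    have hn : ((n + 2 : ℕ) : ℝ) ≤ 2 * ((n + 1 : ℕ) : ℝ) := by
      push_cast
      linarith [Nat.cast_nonneg (α := ℝ) n]
    calc ((n + 2 : ℕ) : ℝ) * (c : ℝ) ^ (n + 2) * (Ψ (Q ^ (n + 2)) : ℝ) ^ s
        = ((n + 2 : ℕ) : ℝ) * ((c : ℝ) ^ (n + 1) * c * (Ψ (Q ^ (n + 1 + 1)) : ℝ) ^ s) := by
          rw [pow_succ (c : ℝ) (n + 1)]
          ring
      _ ≤ 2 * ((n + 1 : ℕ) : ℝ) * ((c : ℝ) ^ (n + 1) * c * (Ψ (Q ^ (n + 1 + 1)) : ℝ) ^ s) :=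
          mul_le_mul_of_nonneg_right hn hX
      _ = _ := by ring

end WellApproximable

end IntrinsicApprox

open IntrinsicApprox in
theorem corollary2p4 {d : ℕ} {A : Type*} [Fintype A] [Nonempty A]
    (p : A → Fin d → ℤ) (q : ℤ) (hq : 2 ≤ q.natAbs)
    (hp : ∃ a b : A, p a ≠ p b)
    (Ψ : ℕ → ℝ≥0) (hΨ : AntitoneOn Ψ (Set.Ici 1))
    (hdiv : ∑' n : ℕ, (((n : ℝ≥0) * (Fintype.card A : ℝ≥0) ^ n *
      Ψ (q.natAbs ^ n) ^ (Real.log (Fintype.card A) / Real.log (q.natAbs : ℝ)) : ℝ≥0) : ℝ≥0∞)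
        = ⊤) :
    IntrinsicApprox.selfSimilarMeasure p q hq
      (IntrinsicApprox.wellApproximable (IntrinsicApprox.selfSimilarSet p q hq) Ψ) = 1 := by
  let : MeasurableSpace A := ⊤
  have : DiscreteMeasurableSpace A := ⟨fun _ => trivial⟩
  have hA : 2 ≤ Fintype.card A := by
    obtain ⟨a, b, hab⟩ := hp
    exact Fintype.one_lt_card_iff.mpr ⟨a, b, fun h => hab (h ▸ rfl)⟩
  have hQ : (2 : ℝ) ≤ q.natAbs := by exact_mod_cast hq
  have hc : (2 : ℝ) ≤ Fintype.card A := by exact_mod_cast hA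
  have hs : 0 < similarityDim A q :=
    div_pos (Real.log_pos (by linarith)) (Real.log_pos (by linarith))
  have hQs : (q.natAbs : ℝ) ^ similarityDim A q = Fintype.card A := by
    have h := ratio_rpow_similarityDim (A := A) hq
    rwa [Real.inv_rpow (by linarith), inv_inj] at h
  obtain ⟨hψ, hns⟩ := pos_and_not_summable_of_tsum_eq_top hq hA hs hΨ hdiv
  obtain ⟨D, hD0, hD⟩ := exists_dist_coding_le p hq
  have hrep := ae_frequently_repeatSet hA
    (monotone_windowStart (ψ := fun n => (Ψ (q.natAbs ^ (n + 1)) : ℝ)) hD0 hQ) windowStart_le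
    (fun h => hns (summable_of_summable_windowStart hD0 hQ hc hs hQs hψ h))
  have hμ : IsSelfSimilarMeasure (ifsMap p q) (naturalWeight A q) (selfSimilarMeasure p q hq) :=
    (existsUnique_isSelfSimilarMeasure p hq).choose_spec.1
  have := hμ.1
  have hirr : ∀ᵐ z ∂selfSimilarMeasure p q hq, ∀ mn : (Fin d → ℤ) × ℕ, z ≠ ratVec mn.1 mn.2 := by
    refine ae_all_iff.mpr fun mn => ?_
    rw [ae_iff]
    simpa using measure_singleton_eq_zero hq hp hμ (ratVec mn.1 mn.2)
  have hmap := selfSimilarMeasure_eq_map p q hq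
  have hirr' : ∀ᵐ x ∂bernoulli A, ∀ mn : (Fin d → ℤ) × ℕ, coding p q x ≠ ratVec mn.1 mn.2 := by
    rw [hmap] at hirr
    exact ae_of_ae_map (measurable_coding p hq).aemeasurable hirr
  have hX := isSelfSimilarSet_range_coding p hq
  have hmeas := measurableSet_wellApproximable hX.2.1.isClosed.measurableSet Ψ
  rw [selfSimilarSet_eq_range, hmap, Measure.map_apply (measurable_coding p hq) hmeas]
  refine (mem_ae_iff_prob_eq_one (measurable_coding p hq hmeas)).mp ?_
  filter_upwards [hrep, hirr'] with x h1 h2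
  exact coding_mem_wellApproximable p hq hΨ hD rfl h1 h2
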